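/- All spaces below carry their usual Polish (or subspace) topologies. For a countable language $L$, the set of $L$-structures with universe $\omega$ carries the logic topology; for an $L_{\omega_1\omega}$-sentence $\Psi$, or a theory $T$, $\mathrm{Mod}(\Psi)$, $\mathrm{Mod}(T)$ denote the subspaces of models with universe $\omega$. An equivalence relation $E$ on $Y$ *Borel reduces* to an equivalence relation $F$ on $Z$, written $(Y,E)\le_B(Z,F)$, if there is a Borel map $f:Y\to Z$ such that $y\,E\,y'\iff f(y)\,F\,f(y')$ for all $y,y'\in Y$; they are *Borel bireducible* if each Borel reduces to the other. $T$ is *Borel complete* if $(\mathrm{Mod}(\Psi),\cong)\le_B(\mathrm{Mod}(T),\cong)$ for every sentence $\Psi$ of $L'_{\omega_1\omega}$ and every countable language $L'$. Let $\mathrm{TK}$ be the following many-sorted first-order theory, with disjoint sorts $U$, $V_i$, $C_i$ ($i\in\omega$), which exhaust every model, and unary function symbols $S_i:V_i\to V_i$, $\pi^0_i:V_i\to C_i$, $\pi^1_i:V_i\to U$, $\tau_{i+1}:C_{i+1}\to C_i$ ($i\in\omega$). Its axioms say: - $U$ and every $V_i$ are infinite, and $|C_i|=2^i$; - $\tau_{i+1}$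 is surjective and $|\tau_{i+1}^{-1}(c)|=2$ for all $c\in C_i$; - for all $c\in C_i$ and $u\in U$ there is $x\in V_i$ with $\pi^0_i(x)=c$ and $\pi^1_i(x)=u$; - $S_i$ is a bijection of $V_i$ without cycles (that is, $S_i^n(x)\neq x$ for all $n\ge 1$ and $x\in V_i$), with $\pi^0_i\circ S_i=\pi^0_i$ and $\pi^1_i\circ S_i=\pi^1_i$. Let $X=\omega^{2^{<\omega}}$ be the space of all colorings $c:2^{<\omega}\to\omega$, and let $G=\mathrm{Aut}(2^{<\omega},\le)$ be the automorphism group of the tree of finite binary sequences ordered by initial segment, acting on $X$ by $(g\cdot c)(s)=c(g^{-1}s)$. Then $G$ acts diagonally on $X^\omega$, $S_\infty=\mathrm{Sym}(\omega)$ acts on $X^\omega$ by permuting the entries of sequences, and these actions commute; let $E_{G\times S_\infty}$ be the orbit equivalence relation of the resulting action of $G\times S_\infty$ on $X^\omega$. Let $\mathrm{Graphs}$ be the space of symmetric irreflexive graphs with vertex set $\omega$. **Theorem.** 1. $(\mathrm{Graphs},\cong)\le_B(X^\omega,E_{G\times S_\infty})$. 2. $(\mathrm{Mod}(\mathrm{TK}),\cong)$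 and $(X^\omega,E_{G\times S_\infty})$ are Borel bireducible. 3. $\mathrm{TK}$ is Borel complete. -/

import Mathlib

/-! ### Borel reducibility -/

/-- `E` Borel reduces to `F`: there is a Borel map `f` with `x E y ↔ f x F f y`. -/
def BorelReducible {α β : Type*} [TopologicalSpace α] [TopologicalSpace β]
    (E : α → α → Prop) (F : β → β → Prop) : Prop :=
  ∃ f : α → β, @Measurable α β (borel α) (borel β) f ∧ ∀ x y, E x y ↔ F (f x) (f y)

/-- `E` and `F` are Borel bireducible. -/
def BorelBireducible {α β : Type*} [TopologicalSpace α] [TopologicalSpace β]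
    (E : α → α → Prop) (F : β → β → Prop) : Prop :=
  BorelReducible E F ∧ BorelReducible F E

/-! ### The space of countable structures -/

/-- The logic topology on the set of `L`-structures with universe `ℕ`: the sets
`{M | f^M(v) = k}`, `{M | R^M(v)}` and `{M | ¬ R^M(v)}` form a subbasis. -/
instance logicTopology (L : FirstOrder.Language) : TopologicalSpace (L.Structure ℕ) :=
  TopologicalSpace.generateFrom
    ({A | ∃ (n : ℕ) (f : L.Functions n) (v : Fin n → ℕ) (k : ℕ),
        A = {M : L.Structure ℕ | M.funMap f v = k}} ∪
     {A | ∃ (n : ℕ) (R : L.Relations n) (v : Fin n → ℕ),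
        A = {M : L.Structure ℕ | M.RelMap R v} ∨ A = {M : L.Structure ℕ | ¬ M.RelMap R v}})

/-- The isomorphism relation on a class `K` of `L`-structures with universe `ℕ`. -/
def IsoOn {L : FirstOrder.Language} (K : Set (L.Structure ℕ)) (M N : K) : Prop :=
  Nonempty (@FirstOrder.Language.Equiv L ℕ ℕ M.1 N.1)

/-! ### The infinitary logic `L_{ω₁ω}` -/

/-- Formulas of `L_{ω₁ω}` with free variables among `x₀, …, x_{n-1}`. -/
inductive InfFormula (L : FirstOrder.Language) : ℕ → Type _
  | falsum {n : ℕ} : InfFormula L n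
  | equal {n : ℕ} (t₁ t₂ : L.Term (Fin n)) : InfFormula L n
  | rel {n k : ℕ} (R : L.Relations k) (ts : Fin k → L.Term (Fin n)) : InfFormula L n
  | neg {n : ℕ} (φ : InfFormula L n) : InfFormula L n
  | conj {n : ℕ} (φ : ℕ → InfFormula L n) : InfFormula L n
  | all {n : ℕ} (φ : InfFormula L (n + 1)) : InfFormula L n

/-- Satisfaction of a formula of `L_{ω₁ω}` in a structure under an assignment. -/
def InfFormula.Realize {L : FirstOrder.Language} {M : Type*} [L.Structure M] :
    {n : ℕ} → InfFormula L n → (Fin n → M) → Prop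
  | _, .falsum, _ => False
  | _, .equal t₁ t₂, v => t₁.realize v = t₂.realize v
  | _, .rel R ts, v => FirstOrder.Language.Structure.RelMap R (fun i => (ts i).realize v)
  | _, .neg φ, v => ¬ φ.Realize v
  | _, .conj φ, v => ∀ i, (φ i).Realize v
  | _, .all φ, v => ∀ x : M, φ.Realize (Fin.snoc v x)

/-- `Mod(Ψ)`: the models with universe `ℕ` of an `L_{ω₁ω}`-sentence `Ψ`. -/
def InfMod {L : FirstOrder.Language} (Ψ : InfFormula L 0) : Set (L.Structure ℕ) :=
  {M | @InfFormula.Realize L ℕ M 0 Ψ Fin.elim0}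

/-- A class `K` of structures with universe `ℕ` is Borel complete if `(Mod(Ψ), ≅)` Borel reduces
to `(K, ≅)` for every sentence `Ψ` of `L'_{ω₁ω}`, for every countable language `L'`. -/
def BorelComplete {L : FirstOrder.Language} (K : Set (L.Structure ℕ)) : Prop :=
  ∀ (L' : FirstOrder.Language.{0, 0}) [Countable L'.Symbols] (Ψ : InfFormula L' 0),
    BorelReducible (IsoOn (InfMod Ψ)) (IsoOn K)

/-! ### Graphs -/

/-- The class of (symmetric, irreflexive) graphs with vertex set `ℕ`. -/
def GraphMod : Set (FirstOrder.Language.graph.Structure ℕ) :=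
  {M | @FirstOrder.Language.Theory.Model FirstOrder.Language.graph ℕ M
    FirstOrder.Language.Theory.simpleGraph}

/-! ### The theory `TK` -/

/-- Function symbols of `TK`: `S i : V i → V i`, `pr0 i : V i → C i`, `pr1 i : V i → U`
and `tau i : C (i + 1) → C i` (usually written `S_i`, `π⁰_i`, `π¹_i`, `τ_{i+1}`). -/
inductive TKFun : ℕ → Type
  | S (i : ℕ) : TKFun 1
  | pr0 (i : ℕ) : TKFun 1
  | pr1 (i : ℕ) : TKFun 1
  | tau (i : ℕ) : TKFun 1

/-- The names of the sorts of `TK`, as unary relation symbols. -/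
inductive TKRel : ℕ → Type
  | U : TKRel 1
  | V (i : ℕ) : TKRel 1
  | C (i : ℕ) : TKRel 1

/-- The language of `TK`. The sorts are unary predicates that partition the universe. -/
def TKLang : FirstOrder.Language := ⟨TKFun, TKRel⟩

namespace TK

variable (M : Type*) [str : TKLang.Structure M]

/-- The elements of `M` of a given sort. -/
def sort (s : TKRel 1) : Set M := {x | str.RelMap (n := 1) s ![x]}

/-- The interpretation in `M` of a function symbol. -/
def app (f : TKFun 1) (x : M) : M := str.funMap (n := 1) f ![x]

/-- The sort on which a function symbol is defined. -/
def dom : TKFun 1 → TKRel 1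
  | .S i => .V i
  | .pr0 i => .V i
  | .pr1 i => .V i
  | .tau i => .C (i + 1)

/-- The sort in which a function symbol takes its values. -/
def cod : TKFun 1 → TKRel 1
  | .S i => .V i
  | .pr0 i => .C i
  | .pr1 _ => .U
  | .tau i => .C i

/-- `M` is a model of `TK`. A many-sorted structure is coded as a one-sorted one: the sorts partition
the universe, and a function symbol is interpreted as the identity off its domain sort. -/
structure IsModel : Prop where
  /-- every element belongs to exactly one sort -/
  exists_unique_sort : ∀ x : M, ∃! s : TKRel 1, x ∈ sort M s
  /-- each function maps its domain sort to its codomain sort -/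
  mapsTo : ∀ f : TKFun 1, Set.MapsTo (app M f) (sort M (dom f)) (sort M (cod f))
  /-- coding convention for many-sorted structures -/
  off_dom : ∀ (f : TKFun 1) (x : M), x ∉ sort M (dom f) → app M f x = x
  infinite_U : (sort M .U).Infinite
  infinite_V : ∀ i, (sort M (.V i)).Infinite
  card_C : ∀ i, (sort M (.C i)).ncard = 2 ^ i
  tau_surj : ∀ i, Set.SurjOn (app M (.tau i)) (sort M (.C (i + 1))) (sort M (.C i))
  tau_fiber : ∀ i, ∀ c ∈ sort M (.C i), {d ∈ sort M (.C (i + 1)) | app M (.tau i) d = c}.ncard = 2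
  fiber_nonempty : ∀ i, ∀ c ∈ sort M (.C i), ∀ u ∈ sort M .U,
    ∃ x ∈ sort M (.V i), app M (.pr0 i) x = c ∧ app M (.pr1 i) x = u
  /-- `S i` is a successor function, as on `ℤ`: a bijection of `V i` without cycles -/
  S_bij : ∀ i, Set.BijOn (app M (.S i)) (sort M (.V i)) (sort M (.V i))
  S_acyclic : ∀ i, ∀ x ∈ sort M (.V i), ∀ n : ℕ, 0 < n → (app M (.S i))^[n] x ≠ x
  pr0_S : ∀ i, ∀ x ∈ sort M (.V i), app M (.pr0 i) (app M (.S i) x) = app M (.pr0 i) x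
  pr1_S : ∀ i, ∀ x ∈ sort M (.V i), app M (.pr1 i) (app M (.S i) x) = app M (.pr1 i) x

end TK

/-- `Mod(TK)`: the models of `TK` with universe `ℕ`. -/
def TKMod : Set (TKLang.Structure ℕ) := {M | @TK.IsModel ℕ M}

/-! ### Colorings of the binary tree -/

/-- `G = Aut(2^{<ω}, ≤)`: the automorphisms of the tree of finite binary sequences, ordered by
initial segment. -/
abbrev TreeAut : Type :=
  ((· <+: ·) : List Bool → List Bool → Prop) ≃r ((· <+: ·) : List Bool → List Bool → Prop)

/-- `X`: the space of colorings of `2^{<ω}` by natural numbers (with the product topology). -/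
abbrev Coloring : Type := List Bool → ℕ

/-- The action of `G × S_∞` on `X^ω`: `G` acts diagonally by `(g · c)(s) = c(g⁻¹ s)`, and
`S_∞` permutes the entries of a sequence. -/
def coloringAct (p : TreeAut × Equiv.Perm ℕ) (x : ℕ → Coloring) : ℕ → Coloring :=
  fun n s => x (p.2⁻¹ n) (p.1⁻¹ s)

/-- `E_{G × S_∞}`: the orbit equivalence relation of the action of `G × S_∞` on `X^ω`. -/
def ColoringEquiv (x y : ℕ → Coloring) : Prop :=
  ∃ p : TreeAut × Equiv.Perm ℕ, coloringAct p x = y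

/-!
A sequence of colorings can name a countable family of branches of the binary tree, by marking the
nodes through which they pass. Give the branches labels in `ℕ` so that every label occurs densely. A
structure on `ℕ` is coded by the colorings indexed by the finite lists of branches. Such a coloring
records at the nodes of level `k` whether the `k`-th atomic relation holds of the labels of its
branches, and whether these labels are distinct. An element of `G × S_∞` that maps one sequence of
colorings to another permutes the branches, and equality of labels is preserved, so that it induces
an isomorphism. Conversely, every permutation of the labels is induced by a tree automorphism, by
a back-and-forth argument that uses density.

In a model of `TK`, the fibers of `(π⁰_i, π¹_i)` are indexed by the nodes of level `i` of a binary
tree and the points of a countable set. Up to isomorphism, the fiber with its successor function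
`S_i` is given by the number of its orbits, which lies in `{1, 2, …, ω}`. With `0` standing for `ω`,
models are sequences of colorings, and an isomorphism is a tree automorphism together with a
permutation of `U`.
-/

/-! ### Back and forth -/

theorem exists_equiv_of_back_and_forth {α β : Type*} [Countable α] [Countable β]
    {P : Finset (α × β) → Prop} (empty : P ∅)
    (inj : ∀ f, P f → ∀ p ∈ f, ∀ q ∈ f, p.1 = q.1 ↔ p.2 = q.2)
    (forth : ∀ f, P f → ∀ a, ∃ b f', P f' ∧ f ⊆ f' ∧ (a, b) ∈ f')
    (back : ∀ f, P f → ∀ b, ∃ a f', P f' ∧ f ⊆ f' ∧ (a, b) ∈ f') :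
    ∃ e : α ≃ β, ∀ a a', ∃ f, P f ∧ (a, e a) ∈ f ∧ (a', e a') ∈ f := by
  cases nonempty_encodable α
  cases nonempty_encodable β
  let D : α ⊕ β → Order.Cofinal {f // P f} := Sum.elim
    (fun a => ⟨{f | ∃ b, (a, b) ∈ f.1}, fun f => by
      obtain ⟨b, f', hf', hsub, hmem⟩ := forth f.1 f.2 a
      exact ⟨⟨f', hf'⟩, ⟨b, hmem⟩, hsub⟩⟩)
    (fun b => ⟨{f | ∃ a, (a, b) ∈ f.1}, fun f => by
      obtain ⟨a, f', hf', hsub, hmem⟩ := back f.1 f.2 b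
      exact ⟨⟨f', hf'⟩, ⟨a, hmem⟩, hsub⟩⟩)
  let I := Order.idealOfCofinals ⟨∅, empty⟩ D
  have meets (x : α ⊕ β) := Order.cofinal_meets_idealOfCofinals ⟨∅, empty⟩ D x
  have total : ∀ a, ∃ b, ∃ f ∈ I, (a, b) ∈ f.1 := fun a => by
    obtain ⟨f, ⟨b, hb⟩, hf⟩ := meets (.inl a)
    exact ⟨b, f, hf, hb⟩
  have onto : ∀ b, ∃ a, ∃ f ∈ I, (a, b) ∈ f.1 := fun b => by
    obtain ⟨f, ⟨a, ha⟩, hf⟩ := meets (.inr b)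
    exact ⟨a, f, hf, ha⟩
  have common : ∀ p q, (∃ f ∈ I, p ∈ f.1) → (∃ f ∈ I, q ∈ f.1) →
      ∃ f, P f ∧ p ∈ f ∧ q ∈ f := by
    rintro p q ⟨f, hf, hp⟩ ⟨g, hg, hq⟩
    obtain ⟨h, -, hfh, hgh⟩ := I.directed _ hf _ hg
    exact ⟨h.1, h.2, hfh hp, hgh hq⟩
  choose F hF using total
  choose G hG using onto
  refine ⟨⟨F, G, fun a => ?_, fun b => ?_⟩, fun a a' => common _ _ (hF a) (hF a')⟩
  · obtain ⟨f, hf, hp, hq⟩ := common _ _ (hG (F a)) (hF a)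
    exact (inj f hf _ hp _ hq).2 rfl
  · obtain ⟨f, hf, hp, hq⟩ := common _ _ (hF (G b)) (hG b)
    exact (inj f hf _ hp _ hq).1 rfl

/-! ### Dense families of branches -/

theorem stream_take_succ_eq_iff {α : Type*} {s t : Stream' α} {n : ℕ} :
    s.take (n + 1) = t.take (n + 1) ↔ s.take n = t.take n ∧ s.get n = t.get n := by
  rw [Stream'.take_succ', Stream'.take_succ', ← List.concat_eq_append, ← List.concat_eq_append,
    List.concat_inj]

theorem stream_take_eq_mono {α : Type*} {s t : Stream' α} {m n : ℕ} (hmn : m ≤ n)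
    (h : s.take n = t.take n) : s.take m = t.take m := by
  simpa [Stream'.take_take, hmn] using congrArg (List.take m) h

theorem exists_stream_take_eq_iff_le {α : Type*} {s t : Stream' α} (h : s ≠ t) :
    ∃ m, ∀ n, s.take n = t.take n ↔ n ≤ m := by
  classical
  have hex : ∃ n, s.take (n + 1) ≠ t.take (n + 1) := by
    by_contra! hall
    exact h (Stream'.take_theorem _ _ fun n => by cases n; exacts [rfl, hall _])
  refine ⟨Nat.find hex, fun n => ⟨fun hn => ?_, fun hn => ?_⟩⟩
  · exact not_lt.1 fun hlt => Nat.find_spec hex (stream_take_eq_mono hlt hn)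
  · cases n with
    | zero => rfl
    | succ n => exact not_not.1 (Nat.find_min hex hn)

theorem stream_take_succ_eq_of_ne_of_ne {s t u : Stream' Bool} {n : ℕ}
    (hs : s.take n = u.take n) (ht : t.take n = u.take n)
    (hs' : s.take (n + 1) ≠ u.take (n + 1)) (ht' : t.take (n + 1) ≠ u.take (n + 1)) :
    s.take (n + 1) = t.take (n + 1) := by
  simp only [Ne, stream_take_succ_eq_iff, hs, ht, true_and] at hs' ht' ⊢
  exact (Bool.eq_not_of_ne hs').trans (Bool.eq_not_of_ne ht').symm

/-- A family of distinct branches of `2^{<ω}`, labelled in such a way that the branches with any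
given label are dense. -/
structure LabelledBranches (ι β : Type*) where
  /-- the branch, as an infinite binary sequence -/
  branch : β → Stream' Bool
  /-- the label of a branch -/
  label : β → ι
  branch_injective : Function.Injective branch
  dense : ∀ (i : ι) (s : List Bool), ∃ b, label b = i ∧ (branch b).take s.length = s

namespace LabelledBranches

variable {ι α β : Type*}

/-- The node of length `k` on a branch. -/
def node (𝓑 : LabelledBranches ι β) (b : β) (k : ℕ) : List Bool := (𝓑.branch b).take k

@[simp] theorem length_node (𝓑 : LabelledBranches ι β) (b : β) (k : ℕ) :
    (𝓑.node b k).length = k := Stream'.length_take _ _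

theorem dropLast_node (𝓑 : LabelledBranches ι β) (b : β) (k : ℕ) :
    (𝓑.node b k).dropLast = 𝓑.node b (k - 1) := Stream'.dropLast_take

theorem node_eq_mono (𝓑 : LabelledBranches ι β) {b b' : β} {j k : ℕ} (hjk : j ≤ k)
    (h : 𝓑.node b k = 𝓑.node b' k) : 𝓑.node b j = 𝓑.node b' j := stream_take_eq_mono hjk h

theorem eq_iff_node_eq (𝓑 : LabelledBranches ι β) {b b' : β} :
    b = b' ↔ ∀ k, 𝓑.node b k = 𝓑.node b' k :=
  ⟨by rintro rfl _; rfl, fun h => 𝓑.branch_injective (Stream'.take_theorem _ _ h)⟩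

/-- The pairs in `f` have equal labels, and `f` preserves the lengths at which branches split. -/
structure IsPartialIso (𝓐 : LabelledBranches ι α) (𝓑 : LabelledBranches ι β)
    (f : Finset (α × β)) : Prop where
  label_eq : ∀ p ∈ f, 𝓐.label p.1 = 𝓑.label p.2
  node_eq_iff : ∀ p ∈ f, ∀ q ∈ f, ∀ k, 𝓐.node p.1 k = 𝓐.node q.1 k ↔ 𝓑.node p.2 k = 𝓑.node q.2 k

variable {𝓐 : LabelledBranches ι α} {𝓑 : LabelledBranches ι β} {f : Finset (α × β)}

theorem IsPartialIso.map_swap (h : IsPartialIso 𝓐 𝓑 f) :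
    IsPartialIso 𝓑 𝓐 (f.map (Equiv.prodComm α β).toEmbedding) where
  label_eq := by
    simpa [Finset.forall_mem_map] using fun b a hp => (h.label_eq (a, b) hp).symm
  node_eq_iff := by
    simpa [Finset.forall_mem_map] using
      fun b a hp b' a' hq k => (h.node_eq_iff (a, b) hp (a', b') hq k).symm

theorem IsPartialIso.insert [DecidableEq (α × β)] (h : IsPartialIso 𝓐 𝓑 f) {a : α} {b : β}
    (hlabel : 𝓐.label a = 𝓑.label b)
    (hnode : ∀ p ∈ f, ∀ k, 𝓐.node p.1 k = 𝓐.node a k ↔ 𝓑.node p.2 k = 𝓑.node b k) :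
    IsPartialIso 𝓐 𝓑 (insert (a, b) f) where
  label_eq := by
    simp only [Finset.forall_mem_insert]
    exact ⟨hlabel, h.label_eq⟩
  node_eq_iff := by
    simp only [Finset.forall_mem_insert, true_and, implies_true]
    exact ⟨fun p hp k => by rw [eq_comm, hnode p hp k, eq_comm],
      fun p hp => ⟨hnode p hp, h.node_eq_iff p hp⟩⟩

theorem IsPartialIso.exists_node_eq_iff (h : IsPartialIso 𝓐 𝓑 f) {a : α}
    (ha : ∀ p ∈ f, p.1 ≠ a) (i : ι) :
    ∃ b, 𝓑.label b = i ∧ ∀ p ∈ f, ∀ k, 𝓐.node p.1 k = 𝓐.node a k ↔ 𝓑.node p.2 k = 𝓑.node b k := by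
  have hlev : ∀ p ∈ f, ∃ m, ∀ k, 𝓐.node p.1 k = 𝓐.node a k ↔ k ≤ m := fun p hp =>
    exists_stream_take_eq_iff_le (𝓐.branch_injective.ne (ha p hp))
  rcases f.eq_empty_or_nonempty with rfl | hne
  · obtain ⟨b, hb, -⟩ := 𝓑.dense i []
    exact ⟨b, hb, by simp⟩
  choose! lev hlev using hlev
  -- `b` leaves the image of a branch that stays with `a` as long as possible, exactly as `a` does.
  obtain ⟨q, hq, hmax⟩ := f.exists_max_image lev hne
  obtain ⟨b, hbi, hb⟩ := 𝓑.dense i (𝓑.node q.2 (lev q) ++ [!(𝓑.branch q.2).get (lev q)])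
  rw [List.length_append, length_node, List.length_singleton, Stream'.take_succ',
    ← List.concat_eq_append, ← List.concat_eq_append, List.concat_inj] at hb
  have hqa : 𝓐.node q.1 (lev q) = 𝓐.node a (lev q) := (hlev q hq _).2 le_rfl
  have hqb : 𝓑.node b (lev q) = 𝓑.node q.2 (lev q) := hb.1
  have hqb' : 𝓑.node b (lev q + 1) ≠ 𝓑.node q.2 (lev q + 1) := fun h => by
    simpa [hb.2] using (stream_take_succ_eq_iff.1 h).2
  refine ⟨b, hbi, fun p hp k => ?_⟩
  rcases le_or_gt k (lev q) with hk | hk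
  · rw [← 𝓐.node_eq_mono hk hqa, 𝓑.node_eq_mono hk hqb]
    exact h.node_eq_iff p hp q hq k
  · have not_le : ∀ m, lev q < m → ¬ 𝓐.node p.1 m = 𝓐.node a m := fun m hm hpa =>
      (((hlev p hp m).1 hpa).trans (hmax p hp)).not_gt hm
    refine iff_of_false (not_le k hk) fun hpb => not_le _ (lev q).lt_succ_self ?_
    have hpb' : 𝓑.node p.2 (lev q + 1) = 𝓑.node b (lev q + 1) := 𝓑.node_eq_mono hk hpb
    have hpq : 𝓐.node p.1 (lev q) = 𝓐.node q.1 (lev q) :=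
      (h.node_eq_iff p hp q hq _).2 ((𝓑.node_eq_mono hk.le hpb).trans hqb)
    exact stream_take_succ_eq_of_ne_of_ne hpq hqa.symm
      (fun h' => hqb' (hpb'.symm.trans ((h.node_eq_iff p hp q hq _).1 h')))
      fun h' => ((hlev q hq _).1 h'.symm).not_gt (lev q).lt_succ_self

theorem IsPartialIso.exists_superset (h : IsPartialIso 𝓐 𝓑 f) (a : α) :
    ∃ b f', IsPartialIso 𝓐 𝓑 f' ∧ f ⊆ f' ∧ (a, b) ∈ f' := by
  classical
  by_cases ha : ∀ p ∈ f, p.1 ≠ a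
  · obtain ⟨b, hlabel, hnode⟩ := h.exists_node_eq_iff ha (𝓐.label a)
    exact ⟨b, _, h.insert hlabel.symm hnode, Finset.subset_insert _ _,
      Finset.mem_insert_self _ _⟩
  · push Not at ha
    obtain ⟨p, hp, rfl⟩ := ha
    exact ⟨p.2, f, h, subset_rfl, hp⟩

theorem exists_equiv [Countable α] [Countable β] (𝓐 : LabelledBranches ι α)
    (𝓑 : LabelledBranches ι β) :
    ∃ e : α ≃ β, (∀ a, 𝓑.label (e a) = 𝓐.label a) ∧
      ∀ a a' k, 𝓐.node a k = 𝓐.node a' k ↔ 𝓑.node (e a) k = 𝓑.node (e a') k := by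
  obtain ⟨e, he⟩ := exists_equiv_of_back_and_forth (P := IsPartialIso 𝓐 𝓑) ⟨by simp, by simp⟩
    (fun f hf p hp q hq => by
      rw [𝓐.eq_iff_node_eq, 𝓑.eq_iff_node_eq]
      exact forall_congr' (hf.node_eq_iff p hp q hq))
    (fun f hf a => hf.exists_superset a)
    (fun f hf b => by
      obtain ⟨a, f', hf', hsub, hmem⟩ := hf.map_swap.exists_superset b
      refine ⟨a, _, hf'.map_swap, fun p hp => ?_, Finset.mem_map_of_mem _ hmem⟩
      exact Finset.mem_map.2 ⟨p.swap, hsub (Finset.mem_map_of_mem _ hp), p.swap_swap⟩)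
  refine ⟨e, fun a => ?_, fun a a' => ?_⟩
  · obtain ⟨f, hf, ha, -⟩ := he a a
    exact (hf.label_eq _ ha).symm
  · obtain ⟨f, hf, ha, ha'⟩ := he a a'
    exact hf.node_eq_iff _ ha _ ha'

/-- The same branches, with labels renamed by `σ`. -/
def relabel {κ : Type*} (𝓑 : LabelledBranches ι β) (σ : ι ≃ κ) : LabelledBranches κ β where
  branch := 𝓑.branch
  label b := σ (𝓑.label b)
  branch_injective := 𝓑.branch_injective
  dense i s := by simpa only [σ.eq_symm_apply] using 𝓑.dense (σ.symm i) s

/-- The branch of a finite set of natural numbers is its indicator sequence; its label is read off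
its largest element, which is independent of any given initial segment. -/
def ofFinsets : LabelledBranches ℕ (Finset ℕ) where
  branch F := Stream'.nats.map fun k => decide (k ∈ F)
  label F := (F.sup id).unpair.2
  branch_injective F F' h := by
    ext k
    exact decide_eq_decide.1 (congrArg (Stream'.get · k) h)
  dense i s := by
    let F := (Finset.range s.length).filter fun j => s[j]? = some true
    have hs : s.length ≤ Nat.pair s.length i := Nat.left_le_pair _ _
    have hsup : F.sup id ≤ Nat.pair s.length i := Finset.sup_le fun j hj =>
      (Finset.mem_range.1 (Finset.mem_filter.1 hj).1).le.trans hs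
    refine ⟨insert (Nat.pair s.length i) F, ?_,
      List.ext_getElem (Stream'.length_take _ _) fun j _ hj => ?_⟩
    · rw [Finset.sup_insert, id_eq, sup_eq_left.2 hsup, Nat.unpair_pair]
    · rw [List.getElem_eq_iff, Stream'.getElem?_take hj, Stream'.get_map, Stream'.get_nats]
      simp [F, hj, (hj.trans_le hs).ne]

end LabelledBranches

/-! ### Automorphisms of the binary tree -/

theorem length_le_length_of_injective {A B : Type*} {f : List A → List B}
    (hinj : Function.Injective f) (hf : ∀ s t, s <+: t → f s <+: f t) (s : List A) :
    s.length ≤ (f s).length := by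
  induction s using List.reverseRecOn with
  | nil => exact Nat.zero_le _
  | append_singleton s a ih =>
    have hpre : f s <+: f (s ++ [a]) := hf _ _ (List.prefix_append _ _)
    have hne : f s ≠ f (s ++ [a]) := hinj.ne (by simp)
    have hlt : (f s).length < (f (s ++ [a])).length :=
      hpre.length_le.lt_of_ne fun h => hne (hpre.eq_of_length h)
    rw [List.length_append, List.length_singleton]
    exact ih.trans_lt hlt

theorem prefix_of_apply_dropLast {A B : Type*} {f : List A → List B}
    (hf : ∀ s, f s.dropLast = (f s).dropLast) {s t : List A} (hst : s <+: t) : f s <+: f t := by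
  induction t using List.reverseRecOn with
  | nil => rw [List.prefix_nil.1 hst]
  | append_singleton t a ih =>
    rcases List.prefix_concat_iff.1 hst with rfl | hst
    · exact List.prefix_rfl
    · have := List.dropLast_prefix (f (t ++ [a]))
      rw [← hf, List.dropLast_concat] at this
      exact (ih hst).trans this

namespace TreeAut

theorem length_apply (g : TreeAut) (s : List Bool) : (g s).length = s.length := by
  have h (g : TreeAut) (s : List Bool) : s.length ≤ (g s).length :=
    length_le_length_of_injective g.injective (fun _ _ => g.map_rel_iff.2) s
  exact le_antisymm (by simpa using h g.symm (g s)) (h g s)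

theorem apply_dropLast (g : TreeAut) (s : List Bool) : g s.dropLast = (g s).dropLast := by
  have h : g s.dropLast <+: g s := g.map_rel_iff.2 (List.dropLast_prefix s)
  have hlen : (g s.dropLast).length = (g s).dropLast.length := by simp [length_apply]
  exact (List.prefix_of_prefix_length_le h (List.dropLast_prefix _) hlen.le).eq_of_length hlen

/-- A bijection of `2^{<ω}` which commutes with the predecessor map, as an automorphism. -/
def ofEquiv (e : List Bool ≃ List Bool) (he : ∀ s, e s.dropLast = (e s).dropLast) : TreeAut where
  toEquiv := e
  map_rel_iff' {s t} := by
    refine ⟨fun h => ?_, prefix_of_apply_dropLast he⟩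
    have he' : ∀ s, e.symm s.dropLast = (e.symm s).dropLast := fun s => by
      rw [e.symm_apply_eq, he, e.apply_symm_apply]
    simpa using prefix_of_apply_dropLast he' h

end TreeAut

namespace LabelledBranches

variable {ι α β : Type*}

theorem exists_node_eq [Nonempty ι] (𝓑 : LabelledBranches ι β) (s : List Bool) :
    ∃ b, 𝓑.node b s.length = s :=
  (𝓑.dense (Classical.arbitrary ι) s).imp fun _ h => h.2

theorem exists_treeAut [Nonempty ι] (𝓐 : LabelledBranches ι α) (𝓑 : LabelledBranches ι β)
    (e : α ≃ β) (he : ∀ a a' k, 𝓐.node a k = 𝓐.node a' k ↔ 𝓑.node (e a) k = 𝓑.node (e a') k) :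
    ∃ g : TreeAut, ∀ a k, g (𝓐.node a k) = 𝓑.node (e a) k := by
  choose below hbelow using 𝓐.exists_node_eq
  let f : List Bool → List Bool := fun s => 𝓑.node (e (below s)) s.length
  have hf : ∀ a k, f (𝓐.node a k) = 𝓑.node (e a) k := fun a k => by
    simp only [f, length_node, ← he]
    simpa using hbelow (𝓐.node a k)
  have hf' : ∀ s a, f s = 𝓑.node (e a) s.length ↔ s = 𝓐.node a s.length := fun s a => by
    rw [← he, hbelow]
  have hlen : ∀ s, (f s).length = s.length := fun s => length_node _ _ _
  have hinj : f.Injective := fun s t h => by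
    have hst : t.length = s.length := by rw [← hlen s, h, hlen]
    rw [← hbelow t, hst]
    exact (hf' s _).1 (by rw [h, ← hst])
  have hsurj : f.Surjective := fun t => by
    obtain ⟨b, hb⟩ := 𝓑.exists_node_eq t
    exact ⟨𝓐.node (e.symm b) t.length, by rw [hf, e.apply_symm_apply, hb]⟩
  refine ⟨TreeAut.ofEquiv (Equiv.ofBijective f ⟨hinj, hsurj⟩) fun s => ?_, hf⟩
  obtain ⟨a, ha⟩ := 𝓐.exists_node_eq s
  rw [← ha, dropLast_node]
  exact (hf a _).trans ((dropLast_node _ _ _).symm.trans (congrArg _ (hf a _).symm))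

end LabelledBranches

/-! ### Borel reductions -/

instance structureMeasurableSpace (L : FirstOrder.Language) : MeasurableSpace (L.Structure ℕ) :=
  borel _

instance structureBorelSpace (L : FirstOrder.Language) : BorelSpace (L.Structure ℕ) := ⟨rfl⟩

theorem measurable_funMap {L : FirstOrder.Language} {n : ℕ} (f : L.Functions n) (v : Fin n → ℕ) :
    Measurable fun M : L.Structure ℕ => M.funMap f v :=
  measurable_to_countable' fun k => IsOpen.measurableSet <|
    TopologicalSpace.isOpen_generateFrom_of_mem (Or.inl ⟨n, f, v, k, rfl⟩)

theorem measurable_relMap {L : FirstOrder.Language} {n : ℕ} (R : L.Relations n) (v : Fin n → ℕ) :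
    Measurable fun M : L.Structure ℕ => M.RelMap R v :=
  measurableSet_setOfPred.1 <| IsOpen.measurableSet <|
    TopologicalSpace.isOpen_generateFrom_of_mem (Or.inr ⟨n, R, v, Or.inl rfl⟩)

theorem BorelReducible.of_measurable {α β : Type*} [TopologicalSpace α] [TopologicalSpace β]
    [MeasurableSpace α] [MeasurableSpace β] [BorelSpace α] [BorelSpace β]
    {E : α → α → Prop} {F : β → β → Prop} {f : α → β} (hf : Measurable f)
    (h : ∀ x y, E x y ↔ F (f x) (f y)) : BorelReducible E F := by
  refine ⟨f, ?_, h⟩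
  rw [← BorelSpace.measurable_eq (α := α), ← BorelSpace.measurable_eq (α := β)]
  exact hf

theorem BorelReducible.trans {α β γ : Type*} [TopologicalSpace α] [TopologicalSpace β]
    [TopologicalSpace γ] {E : α → α → Prop} {F : β → β → Prop} {G : γ → γ → Prop}
    (h₁ : BorelReducible E F) (h₂ : BorelReducible F G) : BorelReducible E G := by
  obtain ⟨f, hf, hEF⟩ := h₁
  obtain ⟨g, hg, hFG⟩ := h₂
  let _ := borel α
  let _ := borel β
  let _ := borel γ
  exact ⟨g ∘ f, hg.comp hf, fun x y => (hEF x y).trans (hFG _ _)⟩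

theorem coloringEquiv_iff {x y : ℕ → Coloring} :
    ColoringEquiv x y ↔ ∃ (g : TreeAut) (σ : Equiv.Perm ℕ), ∀ n s, y (σ n) (g s) = x n s := by
  constructor
  · rintro ⟨⟨g, σ⟩, rfl⟩
    refine ⟨g, σ, fun n s => ?_⟩
    change x (σ⁻¹ (σ n)) (g⁻¹ (g s)) = x n s
    simp
  · rintro ⟨g, σ, h⟩
    refine ⟨⟨g, σ⟩, funext fun n => funext fun s => ?_⟩
    change x (σ⁻¹ n) (g⁻¹ s) = y n s
    simp [← h]

theorem coloringEquiv_comp_iff {I : Type*} (E : ℕ ≃ I) {x y : I → Coloring} :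
    ColoringEquiv (x ∘ E) (y ∘ E) ↔
      ∃ (g : TreeAut) (ρ : Equiv.Perm I), ∀ i s, y (ρ i) (g s) = x i s := by
  rw [coloringEquiv_iff]
  refine exists_congr fun g => ⟨fun ⟨σ, h⟩ => ⟨E.permCongr σ, fun i s => ?_⟩,
    fun ⟨ρ, h⟩ => ⟨E.symm.permCongr ρ, fun n s => ?_⟩⟩
  · simpa using h (E.symm i) s
  · simpa using h (E n) s

/-! ### Coding families of predicates by colorings -/

theorem exists_equiv_comp_eq {α β γ : Type*} {f : α → β} {g : α → γ}
    (hf : Function.Surjective f) (hg : Function.Surjective g)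
    (h : ∀ a a', f a = f a' ↔ g a = g a') : ∃ e : β ≃ γ, ∀ a, e (f a) = g a := by
  have hfg : ∀ a, g (Function.surjInv hf (f a)) = g a := fun a =>
    (h _ _).1 (Function.surjInv_eq hf _)
  refine ⟨Equiv.ofBijective (g ∘ Function.surjInv hf) ⟨fun b b' hb => ?_, fun c => ?_⟩, hfg⟩
  · simpa [Function.surjInv_eq] using (h _ _).2 hb
  · obtain ⟨a, rfl⟩ := hg c
    exact ⟨f a, hfg a⟩

namespace LabelledBranches

variable {ι β : Type*}

theorem label_surjective (𝓑 : LabelledBranches ι β) : Function.Surjective 𝓑.label := fun i =>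
  (𝓑.dense i []).imp fun _ h => h.1

open Classical in
/-- The coloring attached to a list `l` of branches. At a node `s` it records which of these
branches pass through `s`, whether their labels are distinct, and whether the predicate `A k`, where
`k` is the length of `s`, holds of the list of their labels. -/
noncomputable def diagramColoring (𝓑 : LabelledBranches ι β) (A : ℕ → List ι → Prop) (l : List β) :
    Coloring := fun s =>
  Encodable.encode (l.map fun b => decide (𝓑.node b s.length = s),
    decide (l.map 𝓑.label).Nodup, decide (A s.length (l.map 𝓑.label)))

variable {𝓑 : LabelledBranches ι β} {A A' : ℕ → List ι → Prop}

theorem diagramColoring_eq_iff {l l' : List β} {s t : List Bool} :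
    𝓑.diagramColoring A l s = 𝓑.diagramColoring A' l' t ↔
      List.Forall₂ (fun b b' => 𝓑.node b s.length = s ↔ 𝓑.node b' t.length = t) l l' ∧
      ((l.map 𝓑.label).Nodup ↔ (l'.map 𝓑.label).Nodup) ∧
      (A s.length (l.map 𝓑.label) ↔ A' t.length (l'.map 𝓑.label)) := by
  have map_eq_map_iff (p q : β → Bool) :
      l.map p = l'.map q ↔ List.Forall₂ (fun b b' => p b = q b') l l' := by
    rw [← List.forall₂_eq_eq_eq, List.forall₂_map_left_iff, List.forall₂_map_right_iff]
  simp only [diagramColoring, Encodable.encode_inj, Prod.mk.injEq, map_eq_map_iff, decide_eq_decide]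

theorem exists_eq_map_of_forall₂ (g : TreeAut) (ρ : Equiv.Perm (List β))
    (h : ∀ l s, List.Forall₂ (fun b b' => 𝓑.node b s.length = s ↔ 𝓑.node b' (g s).length = g s)
      l (ρ l)) :
    ∃ θ : β → β, Function.Surjective θ ∧ ∀ l, ρ l = l.map θ := by
  have hlen : ∀ l, (ρ l).length = l.length := fun l => (h l []).length_eq.symm
  choose θ hθ using fun b => List.length_eq_one_iff.1 (hlen [b])
  have node_θ : ∀ b k, 𝓑.node (θ b) k = g (𝓑.node b k) := fun b k => by
    have := h [b] (𝓑.node b k)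
    rw [hθ, List.forall₂_cons] at this
    simpa [TreeAut.length_apply] using this.1
  refine ⟨θ, fun b => ?_, fun l => ?_⟩
  · obtain ⟨b', hb'⟩ := List.length_eq_one_iff.1 ((hlen (ρ.symm [b])).symm.trans (by simp))
    exact ⟨b', by simpa [← hb'] using (hθ b').symm⟩
  · refine List.ext_getElem (by simp [hlen]) fun j hj hj' => 𝓑.eq_iff_node_eq.2 fun k => ?_
    rw [List.length_map] at hj'
    have := List.Forall₂.get (h l (𝓑.node l[j] k)) hj' hj
    simpa [TreeAut.length_apply, node_θ] using this

theorem exists_perm_of_diagramColoring_eq {g : TreeAut} {ρ : Equiv.Perm (List β)}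
    (h : ∀ l s, 𝓑.diagramColoring A' (ρ l) (g s) = 𝓑.diagramColoring A l s) :
    ∃ σ : Equiv.Perm ι, ∀ k l, A k l ↔ A' k (l.map σ) := by
  have h' := fun l s => diagramColoring_eq_iff.1 (h l s).symm
  obtain ⟨θ, hθ, hρ⟩ := exists_eq_map_of_forall₂ g ρ fun l s => (h' l s).1
  have hker : ∀ b b', 𝓑.label b = 𝓑.label b' ↔ 𝓑.label (θ b) = 𝓑.label (θ b') := fun b b' => by
    have := (h' [b, b'] []).2.1
    rw [hρ] at this
    simpa [not_iff_not] using this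
  obtain ⟨σ, hσ⟩ := exists_equiv_comp_eq 𝓑.label_surjective (𝓑.label_surjective.comp hθ) hker
  refine ⟨σ, fun k l => ?_⟩
  obtain ⟨l, rfl⟩ := List.map_surjective_iff.2 𝓑.label_surjective l
  have := (h' l (List.replicate k false)).2.2
  simpa [hρ, TreeAut.length_apply, Function.comp_def, hσ] using this

theorem exists_diagramColoring_eq [Nonempty ι] [Countable β] (σ : Equiv.Perm ι)
    (hσ : ∀ k l, A k l ↔ A' k (l.map σ)) : ∃ (g : TreeAut) (ρ : Equiv.Perm (List β)),
      ∀ l s, 𝓑.diagramColoring A' (ρ l) (g s) = 𝓑.diagramColoring A l s := by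
  obtain ⟨θ, hlabel, hnode⟩ := (𝓑.relabel σ).exists_equiv 𝓑
  obtain ⟨g, hg⟩ := (𝓑.relabel σ).exists_treeAut 𝓑 θ hnode
  have map_label (l : List β) : (l.map θ).map 𝓑.label = (l.map 𝓑.label).map σ := by
    rw [List.map_map, List.map_map]
    exact List.map_congr_left fun b _ => hlabel b
  refine ⟨g, Equiv.listEquivOfEquiv θ, fun l s => (diagramColoring_eq_iff.2 ⟨?_, ?_, ?_⟩).symm⟩
  · refine List.forall₂_map_right_iff.2 (List.forall₂_same.2 fun b _ => ?_)
    rw [TreeAut.length_apply, ← hg, g.injective.eq_iff]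
    rfl
  · exact (List.nodup_map_iff σ.injective).symm.trans (by rw [← map_label]; rfl)
  · rw [TreeAut.length_apply, hσ, ← map_label]
    rfl

theorem coloringEquiv_diagramColoring_iff [Nonempty ι] [Countable β] (E : ℕ ≃ List β) :
    ColoringEquiv (𝓑.diagramColoring A ∘ E) (𝓑.diagramColoring A' ∘ E) ↔
      ∃ σ : Equiv.Perm ι, ∀ k l, A k l ↔ A' k (l.map σ) := by
  rw [coloringEquiv_comp_iff]
  exact ⟨fun ⟨_, _, h⟩ => exists_perm_of_diagramColoring_eq h,
    fun ⟨σ, hσ⟩ => exists_diagramColoring_eq σ hσ⟩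

end LabelledBranches

/-! ### Coding countable structures by colorings -/

open FirstOrder Language

/-- The graphs of the symbols of a language in a structure, as predicates on lists; the list of a
function symbol begins with the value of the function. -/
def atomicDiagram {L : FirstOrder.Language} (M : Type*) [L.Structure M] : L.Symbols → List M → Prop
  | .inl ⟨n, f⟩, l => ∃ v : Fin n → M, l = Structure.funMap f v :: List.ofFn v
  | .inr ⟨n, R⟩, l => ∃ v : Fin n → M, l = List.ofFn v ∧ Structure.RelMap R v

section AtomicDiagram

variable {L : FirstOrder.Language} {M N : Type*} [L.Structure M] [L.Structure N]

theorem atomicDiagram_map (e : M ≃[L] N) {a : L.Symbols} {l : List M} (h : atomicDiagram M a l) :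
    atomicDiagram N a (l.map e) := by
  rcases a with ⟨n, f⟩ | ⟨n, R⟩
  · obtain ⟨v, rfl⟩ := h
    exact ⟨e ∘ v, by rw [List.map_cons, List.map_ofFn, e.map_fun]⟩
  · obtain ⟨v, rfl, hv⟩ := h
    exact ⟨e ∘ v, List.map_ofFn, (e.map_rel R v).2 hv⟩

theorem atomicDiagram_map_iff (e : M ≃[L] N) {a : L.Symbols} {l : List M} :
    atomicDiagram N a (l.map e) ↔ atomicDiagram M a l := by
  refine ⟨fun h => ?_, atomicDiagram_map e⟩
  have := atomicDiagram_map e.symm h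
  rwa [List.map_map, show e.symm ∘ e = id from funext e.symm_apply_apply, List.map_id] at this

theorem atomicDiagram_cons_ofFn {n : ℕ} {f : L.Functions n} {x : M} {v : Fin n → M} :
    atomicDiagram M (.inl ⟨n, f⟩ : L.Symbols) (x :: List.ofFn v) ↔ x = Structure.funMap f v := by
  simp only [atomicDiagram, List.cons.injEq, List.ofFn_injective.eq_iff, exists_eq_right']

theorem atomicDiagram_ofFn {n : ℕ} {R : L.Relations n} {v : Fin n → M} :
    atomicDiagram M (.inr ⟨n, R⟩ : L.Symbols) (List.ofFn v) ↔ Structure.RelMap R v := by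
  simp only [atomicDiagram, List.ofFn_injective.eq_iff, exists_eq_left']

theorem nonempty_equiv_iff_atomicDiagram :
    Nonempty (M ≃[L] N) ↔
      ∃ σ : M ≃ N, ∀ (a : L.Symbols) (l : List M),
        atomicDiagram M a l ↔ atomicDiagram N a (l.map σ) := by
  refine ⟨fun ⟨e⟩ => ⟨e.toEquiv, fun a l => (atomicDiagram_map_iff e).symm⟩, fun ⟨σ, hσ⟩ => ?_⟩
  refine ⟨{ toEquiv := σ, map_fun' := fun {n} f v => ?_, map_rel' := fun {n} R v => ?_ }⟩
  · have := (hσ _ _).1 (atomicDiagram_cons_ofFn (f := f) (v := v) |>.2 rfl)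
    rw [List.map_cons, List.map_ofFn] at this
    exact atomicDiagram_cons_ofFn.1 this
  · have := hσ (.inr ⟨n, R⟩) (List.ofFn v)
    rw [List.map_ofFn, atomicDiagram_ofFn, atomicDiagram_ofFn] at this
    exact this.symm

end AtomicDiagram

theorem measurable_atomicDiagram {L : FirstOrder.Language} (a : L.Symbols) (l : List ℕ) :
    Measurable fun M : L.Structure ℕ => @atomicDiagram L ℕ M a l := by
  rcases a with ⟨n, f⟩ | ⟨n, R⟩
  · refine Measurable.exists fun v => ?_
    rcases l with _ | ⟨b, l⟩
    · simp only [reduceCtorEq, measurable_const]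
    · simp only [List.cons.injEq]
      exact (measurableSet_setOfPred.1
        (measurableSet_eq_fun measurable_const (measurable_funMap f v))).and measurable_const
  · exact Measurable.exists fun v => measurable_const.and (measurable_relMap R v)

theorem isoOn_borelReducible_coloringEquiv {L : FirstOrder.Language} [Countable L.Symbols]
    (K : Set (L.Structure ℕ)) : BorelReducible (IsoOn K) ColoringEquiv := by
  classical
  cases nonempty_encodable L.Symbols
  obtain ⟨E⟩ : Nonempty (ℕ ≃ List (Finset ℕ)) := nonempty_equiv_of_countable
  let A (M : K) (k : ℕ) (l : List ℕ) : Prop :=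
    ∃ a ∈ (Encodable.decode k : Option L.Symbols), @atomicDiagram L ℕ M.1 a l
  refine BorelReducible.of_measurable
    (f := fun M : K => LabelledBranches.ofFinsets.diagramColoring (A M) ∘ E) ?_ fun M N => ?_
  · refine measurable_pi_lambda _ fun n => measurable_pi_lambda _ fun s => ?_
    have hA : Measurable fun M : K => A M s.length ((E n).map LabelledBranches.ofFinsets.label) :=
      Measurable.exists fun a => measurable_const.and
        ((measurable_atomicDiagram a _).comp measurable_subtype_coe)
    exact measurable_from_top.comp (g := fun p : Prop => Encodable.encode (_, _, decide p)) hA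
  · have hA (M : K) (a : L.Symbols) (l : List ℕ) :
        A M (Encodable.encode a) l ↔ @atomicDiagram L ℕ M.1 a l := by
      simp only [A, Encodable.encodek, Option.mem_some_iff, exists_eq_left']
    refine (@nonempty_equiv_iff_atomicDiagram L ℕ ℕ M.1 N.1).trans <| Iff.trans ?_
      (LabelledBranches.coloringEquiv_diagramColoring_iff E).symm
    exact exists_congr fun σ =>
      ⟨fun h k l => exists_congr fun a => and_congr_right fun _ => h a l,
        fun h a l => by rw [← hA, ← hA, h]⟩

/-! ### Permutations without finite cycles -/

theorem nonempty_equiv_of_card_eq {α β : Type*} [Countable α] [Countable β] [Nonempty α]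
    [Nonempty β] (h : Nat.card α = Nat.card β) : Nonempty (α ≃ β) := by
  rcases finite_or_infinite α with hα | hα
  · have : Finite β := Nat.finite_of_card_ne_zero (h ▸ Nat.card_pos.ne')
    exact Finite.card_eq.1 h
  · have : Infinite β := not_finite_iff_infinite.1 fun hβ =>
      Nat.card_pos.ne' (h.symm.trans Nat.card_eq_zero_of_infinite)
    exact nonempty_equiv_of_countable

theorem ncard_setOf_least_eq_card_quotient {α : Type*} [LinearOrder α] [WellFoundedLT α]
    (s : Setoid α) : {a : α | ∀ b, s a b → a ≤ b}.ncard = Nat.card (Quotient s) := by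
  refine Nat.card_eq_of_bijective (fun a => (⟦a.1⟧ : Quotient s)) ⟨fun a b h => ?_, fun q => ?_⟩
  · have hab : s a.1 b.1 := Quotient.exact h
    exact Subtype.ext (le_antisymm (a.2 _ hab) (b.2 _ (s.symm hab)))
  · induction q using Quotient.inductionOn with | h a => ?_
    obtain ⟨m, hm, hmin⟩ := wellFounded_lt.has_min {b | s a b} ⟨a, s.refl a⟩
    exact ⟨⟨m, fun b hb => not_lt.1 (hmin b (s.trans hm hb))⟩, Quotient.sound (s.symm hm)⟩

section NumOrbits

variable {α β : Type*} {f : Equiv.Perm α} {g : Equiv.Perm β}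

/-- The number of orbits of a permutation, where `0` stands for infinitely many. -/
noncomputable def numOrbits (f : Equiv.Perm α) : ℕ :=
  Nat.card (Quotient (Equiv.Perm.SameCycle.setoid f))

theorem eq_permCongr_of_semiconj {e : α ≃ β} (h : Function.Semiconj e f g) :
    g = e.permCongr f := by
  ext b
  rw [Equiv.permCongr_apply, h (e.symm b), e.apply_symm_apply]

theorem numOrbits_eq_of_semiconj {e : α ≃ β} (h : Function.Semiconj e f g) :
    numOrbits f = numOrbits g := by
  refine Nat.card_congr (Quotient.congr e fun a b => exists_congr fun z => ?_)
  have : g ^ z = e.permCongr (f ^ z) := by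
    rw [eq_permCongr_of_semiconj h]
    exact (map_zpow e.permCongrHom f z).symm
  rw [this, Equiv.permCongr_apply, e.symm_apply_apply, e.apply_eq_iff_eq]

theorem zpow_apply_injective (hf : Function.periodicPts f = ∅) (a : α) :
    Function.Injective fun z : ℤ => (f ^ z) a := by
  have key (m : ℤ) (n : ℕ) (h : (f ^ (m + n)) a = (f ^ m) a) : n = 0 := by
    by_contra hn
    refine Set.eq_empty_iff_forall_notMem.1 hf ((f ^ m) a) ⟨n, Nat.pos_of_ne_zero hn, ?_⟩
    rw [Function.IsPeriodicPt, Function.IsFixedPt, Equiv.Perm.iterate_eq_pow, ← zpow_natCast,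
      ← Equiv.Perm.mul_apply, ← zpow_add, add_comm, h]
  intro m n h
  rcases le_total m n with hmn | hmn <;> obtain ⟨k, rfl⟩ := Int.le.dest hmn
  · simp [key m k h.symm]
  · simp [key n k h]

/-- The permutation of `ι × ℤ` that acts as the successor on every copy of `ℤ`. -/
def shift (ι : Type*) : Equiv.Perm (ι × ℤ) := (Equiv.refl ι).prodCongr (Equiv.addRight 1)

theorem shift_zpow_apply {ι : Type*} (z : ℤ) (p : ι × ℤ) : (shift ι ^ z) p = (p.1, p.2 + z) := by
  induction z generalizing p with
  | zero => simp
  | succ n ih =>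
    rw [zpow_add_one, Equiv.Perm.mul_apply, ih]
    exact Prod.ext rfl ((add_assoc _ _ _).trans (congrArg _ (add_comm 1 _)))
  | pred n ih =>
    rw [zpow_sub_one, Equiv.Perm.mul_apply, ih]
    exact Prod.ext rfl ((add_right_comm _ (-1) _).trans (add_assoc _ _ _))

theorem periodicPts_shift (ι : Type*) : Function.periodicPts (shift ι) = ∅ := by
  refine Set.eq_empty_iff_forall_notMem.2 fun p ⟨n, hn, hp⟩ => hn.ne' ?_
  rw [Function.IsPeriodicPt, Function.IsFixedPt, Equiv.Perm.iterate_eq_pow, ← zpow_natCast,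
    shift_zpow_apply] at hp
  simpa using congrArg Prod.snd hp

theorem numOrbits_shift (ι : Type*) : numOrbits (shift ι) = Nat.card ι := by
  refine (Nat.card_eq_of_bijective (fun i => ⟦(i, (0 : ℤ))⟧) ⟨fun i j h => ?_, fun q => ?_⟩).symm
  · obtain ⟨z, hz⟩ := Quotient.exact h
    exact congrArg Prod.fst ((shift_zpow_apply z _).symm.trans hz)
  · induction q using Quotient.inductionOn with | h p => ?_
    exact ⟨p.1, Quotient.sound ⟨p.2, by simp [shift_zpow_apply]⟩⟩

/-- The orbits of a permutation without finite cycles, identified with copies of `ℤ`. -/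
noncomputable def orbitEquiv (f : Equiv.Perm α) (hf : Function.periodicPts f = ∅) :
    Quotient (Equiv.Perm.SameCycle.setoid f) × ℤ ≃ α :=
  Equiv.ofBijective (fun p => (f ^ p.2) p.1.out) <| by
    refine ⟨fun ⟨q, m⟩ ⟨r, n⟩ h => ?_, fun a => ?_⟩
    · have hqr : f.SameCycle q.out r.out := by
        rw [← Equiv.Perm.sameCycle_zpow_left (n := m), ← Equiv.Perm.sameCycle_zpow_right (n := n)]
        exact Eq.sameCycle h f
      obtain rfl : q = r := by rw [← q.out_eq, ← r.out_eq]; exact Quotient.sound hqr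
      exact congrArg _ (zpow_apply_injective hf _ h)
    · obtain ⟨z, hz⟩ : f.SameCycle (⟦a⟧ : Quotient (Equiv.Perm.SameCycle.setoid f)).out a :=
        Quotient.mk_out (s := Equiv.Perm.SameCycle.setoid f) a
      exact ⟨(⟦a⟧, z), hz⟩

theorem orbitEquiv_semiconj (hf : Function.periodicPts f = ∅) :
    Function.Semiconj (orbitEquiv f hf) (shift _) f := fun ⟨q, z⟩ => by
  change (f ^ (z + 1)) q.out = f ((f ^ z) q.out)
  rw [add_comm, zpow_add, zpow_one, Equiv.Perm.mul_apply]

theorem exists_semiconj_of_numOrbits_eq [Countable α] [Countable β] [Nonempty α] [Nonempty β]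
    (hf : Function.periodicPts f = ∅) (hg : Function.periodicPts g = ∅)
    (h : numOrbits f = numOrbits g) : ∃ e : α ≃ β, Function.Semiconj e f g := by
  have := ‹Nonempty α›.map (Quotient.mk (Equiv.Perm.SameCycle.setoid f))
  have := ‹Nonempty β›.map (Quotient.mk (Equiv.Perm.SameCycle.setoid g))
  obtain ⟨ε⟩ := nonempty_equiv_of_card_eq h
  refine ⟨(orbitEquiv f hf).symm.trans ((ε.prodCongr (.refl ℤ)).trans (orbitEquiv g hg)),
    fun a => ?_⟩
  obtain ⟨p, rfl⟩ := (orbitEquiv f hf).surjective a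
  simp only [← (orbitEquiv_semiconj hf) p, Equiv.trans_apply, Equiv.symm_apply_apply]
  exact orbitEquiv_semiconj hg (ε.prodCongr (.refl ℤ) p)

theorem exists_perm_numOrbits_eq (k : ℕ) :
    ∃ f : Equiv.Perm ℕ, Function.periodicPts f = ∅ ∧ numOrbits f = k := by
  have : Countable (ZMod k) := ZMod.intCast_surjective.countable
  obtain ⟨e⟩ : Nonempty (ZMod k × ℤ ≃ ℕ) := nonempty_equiv_of_countable
  have he : Function.Semiconj e (shift (ZMod k)) (e.permCongr (shift (ZMod k))) :=
    fun p => by simp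
  have he' : Function.Semiconj e.symm (e.permCongr (shift (ZMod k))) (shift (ZMod k)) :=
    he.inverse_left e.left_inv e.right_inv
  refine ⟨e.permCongr (shift (ZMod k)), ?_, ?_⟩
  · simpa [periodicPts_shift] using he'.mapsTo_periodicPts
  · rw [← numOrbits_eq_of_semiconj he, numOrbits_shift, Nat.card_zmod]

end NumOrbits

/-- A permutation of `ℕ` without finite cycles and with `k` orbits, or infinitely many if
`k = 0`. -/
noncomputable def acyclicPerm (k : ℕ) : Equiv.Perm ℕ := (exists_perm_numOrbits_eq k).choose

theorem periodicPts_acyclicPerm (k : ℕ) : Function.periodicPts (acyclicPerm k) = ∅ :=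
  (exists_perm_numOrbits_eq k).choose_spec.1

theorem numOrbits_acyclicPerm (k : ℕ) : numOrbits (acyclicPerm k) = k :=
  (exists_perm_numOrbits_eq k).choose_spec.2

/-- The least elements of the orbits in `F` of a permutation `S` of `F`. -/
def orbitReps {α : Type*} [LE α] (S : α → α) (F : Set α) : Set α :=
  {a ∈ F | ∀ b ∈ F, (∃ n, S^[n] a = b ∨ S^[n] b = a) → a ≤ b}

theorem sameCycle_iff_exists_iterate_eq {α : Type*} {f : Equiv.Perm α} {a b : α} :
    f.SameCycle a b ↔ ∃ n, f^[n] a = b ∨ f^[n] b = a := by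
  simp only [Equiv.Perm.iterate_eq_pow]
  refine ⟨fun ⟨z, hz⟩ => ?_, ?_⟩
  · obtain ⟨n, rfl | rfl⟩ := z.eq_nat_or_neg
    · exact ⟨n, .inl (by simpa using hz)⟩
    · exact ⟨n, .inr (by simp [← hz])⟩
  · rintro ⟨n, rfl | rfl⟩
    · exact ⟨n, by simp⟩
    · exact ⟨-n, by simp⟩

theorem ncard_orbitReps {α : Type*} [LinearOrder α] [WellFoundedLT α] {S : α → α} {F : Set α}
    (hS : Set.BijOn S F F) : (orbitReps S F).ncard = numOrbits (hS.equiv S) := by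
  have iterate (n : ℕ) (a : F) : ((hS.equiv S)^[n] a : α) = S^[n] a :=
    (show Function.Semiconj Subtype.val (hS.equiv S) S from fun _ => rfl).iterate_right n a
  have sameCycle_iff (a b : F) : Equiv.Perm.SameCycle (hS.equiv S) a b ↔
      ∃ n, S^[n] a = b ∨ S^[n] b = a := by
    simp only [sameCycle_iff_exists_iterate_eq, Subtype.ext_iff, iterate]
  rw [numOrbits, ← ncard_setOf_least_eq_card_quotient,
    ← Set.ncard_image_of_injective _ Subtype.val_injective]
  congr 1
  ext a
  simp only [orbitReps, Set.mem_ofPred_eq, Set.mem_image, Subtype.exists, exists_and_right,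
    exists_eq_right]
  exact ⟨fun ⟨ha, h⟩ => ⟨ha, fun b hb => h b b.2 ((sameCycle_iff ⟨a, ha⟩ b).1 hb)⟩,
    fun ⟨ha, h⟩ => ⟨ha, fun b hb hab => h ⟨b, hb⟩ ((sameCycle_iff ⟨a, ha⟩ ⟨b, hb⟩).2 hab)⟩⟩

namespace TK

/-! ### Isomorphisms of models of `TK` -/

section Isomorphism

variable {M N : Type*} [TKLang.Structure M] [TKLang.Structure N]

theorem comp_vec_one {α β : Type*} (φ : α → β) (v : Fin 1 → α) : φ ∘ v = ![φ (v 0)] := by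
  ext i
  rw [Subsingleton.elim i 0]
  rfl

theorem map_app (φ : M ≃[TKLang] N) (f : TKFun 1) (a : M) : φ (app M f a) = app N f (φ a) :=
  (φ.map_fun (n := 1) f ![a]).trans (congrArg _ (comp_vec_one φ _))

theorem map_mem_sort_iff (φ : M ≃[TKLang] N) (s : TKRel 1) (a : M) :
    φ a ∈ sort N s ↔ a ∈ sort M s := by
  have := φ.map_rel (n := 1) s ![a]
  rwa [comp_vec_one] at this

/-- An isomorphism of `TK`-structures from its action on sorts and unary functions. -/
def equivOfUnary (e : M ≃ N) (happ : ∀ f a, e (app M f a) = app N f (e a))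
    (hsort : ∀ s a, e a ∈ sort N s ↔ a ∈ sort M s) : M ≃[TKLang] N where
  toEquiv := e
  map_fun' := fun {n} f v => by
    match n, f with
    | 1, f =>
      obtain ⟨a, rfl⟩ : ∃ a, v = ![a] := ⟨v 0, comp_vec_one id v⟩
      rw [comp_vec_one]
      exact happ f a
  map_rel' := fun {n} R v => by
    match n, R with
    | 1, s =>
      obtain ⟨a, rfl⟩ : ∃ a, v = ![a] := ⟨v 0, comp_vec_one id v⟩
      rw [comp_vec_one]
      exact hsort s a

theorem image_sort (φ : M ≃[TKLang] N) (s : TKRel 1) : φ '' sort M s = sort N s := by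
  ext b
  obtain ⟨a, rfl⟩ := φ.surjective b
  rw [φ.injective.mem_set_image, map_mem_sort_iff]

theorem image_tau_fiber (φ : M ≃[TKLang] N) (i : ℕ) (c : M) :
    φ '' {d ∈ sort M (.C (i + 1)) | app M (.tau i) d = c} =
      {d ∈ sort N (.C (i + 1)) | app N (.tau i) d = φ c} := by
  ext b
  obtain ⟨a, rfl⟩ := φ.surjective b
  simp only [φ.injective.mem_set_image, Set.mem_ofPred_eq, map_mem_sort_iff, ← map_app φ,
    φ.injective.eq_iff]

theorem IsModel.of_equiv (φ : M ≃[TKLang] N) (hM : IsModel M) : IsModel N := by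
  have happ (f : TKFun 1) : Function.Semiconj φ (app M f) (app N f) := map_app φ f
  have hinj := φ.injective
  have forall_mem_sort {s : TKRel 1} {P : N → Prop} (h : ∀ a ∈ sort M s, P (φ a)) :
      ∀ b ∈ sort N s, P b := image_sort φ s ▸ Set.forall_mem_image.2 h
  refine
    { exists_unique_sort := φ.surjective.forall.2 fun a => ?_
      mapsTo := fun f => ?_
      off_dom := fun f => φ.surjective.forall.2 fun a ha => ?_
      infinite_U := image_sort φ .U ▸ hM.infinite_U.image hinj.injOn
      infinite_V := fun i => image_sort φ (.V i) ▸ (hM.infinite_V i).image hinj.injOn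
      card_C := fun i => ?_
      tau_surj := fun i => ?_
      tau_fiber := fun i => forall_mem_sort fun c hc => ?_
      fiber_nonempty := fun i => forall_mem_sort fun c hc => forall_mem_sort fun u hu => ?_
      S_bij := fun i => ?_
      S_acyclic := fun i => forall_mem_sort fun a ha n hn h => ?_
      pr0_S := fun i => forall_mem_sort fun a ha => ?_
      pr1_S := fun i => forall_mem_sort fun a ha => ?_ }
  · simpa only [map_mem_sort_iff] using hM.exists_unique_sort a
  · simpa only [← image_sort φ] using (happ f).mapsTo_image (hM.mapsTo f)
  · rw [← map_app, hM.off_dom f a ((map_mem_sort_iff φ _ a).not.1 ha)]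
  · rw [← image_sort φ, Set.ncard_image_of_injective _ hinj, hM.card_C]
  · simpa only [← image_sort φ] using (happ _).surjOn_image (hM.tau_surj i)
  · rw [← image_tau_fiber, Set.ncard_image_of_injective _ hinj, hM.tau_fiber i c hc]
  · obtain ⟨x, hx, rfl, rfl⟩ := hM.fiber_nonempty i c hc u hu
    exact ⟨φ x, (map_mem_sort_iff φ _ x).2 hx, (map_app φ _ x).symm, (map_app φ _ x).symm⟩
  · simpa only [← image_sort φ] using (happ _).bijOn_image (hM.S_bij i) hinj.injOn
  · exact hM.S_acyclic i a ha n hn (hinj (((happ _).iterate_right n a).trans h))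
  · rw [← map_app, ← map_app, ← map_app, hM.pr0_S i a ha]
  · rw [← map_app, ← map_app, ← map_app, hM.pr1_S i a ha]

theorem IsModel.nonempty_equiv_of_bijOn_sort (hM : IsModel M) (hN : IsModel N) {φ : M → N}
    (hsort : ∀ s, Set.BijOn φ (sort M s) (sort N s))
    (happ : ∀ f, ∀ a ∈ sort M (dom f), φ (app M f a) = app N f (φ a)) :
    Nonempty (M ≃[TKLang] N) := by
  have mem_sort_iff (s : TKRel 1) (a : M) : φ a ∈ sort N s ↔ a ∈ sort M s := by
    refine ⟨fun h => ?_, fun h => (hsort s).mapsTo h⟩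
    obtain ⟨t, ht, -⟩ := hM.exists_unique_sort a
    rwa [(hN.exists_unique_sort _).unique h ((hsort t).mapsTo ht)]
  have hφ : Function.Bijective φ := by
    refine ⟨fun a b hab => ?_, fun b => ?_⟩
    · obtain ⟨s, hs, -⟩ := hM.exists_unique_sort a
      exact (hsort s).injOn hs ((mem_sort_iff s b).1 (hab ▸ (hsort s).mapsTo hs)) hab
    · obtain ⟨s, hs, -⟩ := hN.exists_unique_sort b
      obtain ⟨a, -, ha⟩ := (hsort s).surjOn hs
      exact ⟨a, ha⟩
  refine ⟨equivOfUnary (.ofBijective φ hφ) (fun f a => ?_) mem_sort_iff⟩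
  by_cases ha : a ∈ sort M (dom f)
  · exact happ f a ha
  · exact (congrArg φ (hM.off_dom f a ha)).trans
      (hN.off_dom f _ ((mem_sort_iff _ _).not.2 ha)).symm

end Isomorphism

/-! ### Fibers of models of `TK` -/

section Fiber

variable {M N : Type*} [TKLang.Structure M] [TKLang.Structure N]

variable (M) in
/-- The set of `x ∈ V i` that `π⁰` and `π¹` map to given points of `C i` and `U`. -/
def fiber (i : ℕ) (c u : M) : Set M :=
  {x ∈ sort M (.V i) | app M (.pr0 i) x = c ∧ app M (.pr1 i) x = u}

theorem IsModel.bijOn_fiber (hM : IsModel M) (i : ℕ) (c u : M) :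
    Set.BijOn (app M (.S i)) (fiber M i c u) (fiber M i c u) := by
  refine ⟨fun x hx => ⟨(hM.S_bij i).mapsTo hx.1, (hM.pr0_S i x hx.1).trans hx.2.1,
    (hM.pr1_S i x hx.1).trans hx.2.2⟩, (hM.S_bij i).injOn.mono fun x hx => hx.1, fun x hx => ?_⟩
  obtain ⟨y, hy, rfl⟩ := (hM.S_bij i).surjOn hx.1
  exact ⟨y, ⟨hy, (hM.pr0_S i y hy).symm.trans hx.2.1, (hM.pr1_S i y hy).symm.trans hx.2.2⟩, rfl⟩

/-- The permutation of a fiber given by the successor function of a model. -/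
noncomputable def IsModel.fiberPerm (hM : IsModel M) (i : ℕ) (c u : M) :
    Equiv.Perm (fiber M i c u) :=
  (hM.bijOn_fiber i c u).equiv _

theorem IsModel.periodicPts_fiberPerm (hM : IsModel M) (i : ℕ) (c u : M) :
    Function.periodicPts (hM.fiberPerm i c u) = ∅ := by
  have hval : Function.Semiconj Subtype.val (hM.fiberPerm i c u) (app M (.S i)) := fun _ => rfl
  refine Set.eq_empty_iff_forall_notMem.2 fun x hx => ?_
  obtain ⟨n, hn, h⟩ := hval.mapsTo_periodicPts hx
  exact hM.S_acyclic i x x.2.1 n hn h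

theorem map_mem_fiber_iff (φ : M ≃[TKLang] N) {i : ℕ} {c u x : M} :
    φ x ∈ fiber N i (φ c) (φ u) ↔ x ∈ fiber M i c u := by
  simp only [fiber, Set.mem_ofPred_eq, map_mem_sort_iff, ← map_app, φ.injective.eq_iff]

theorem IsModel.numOrbits_fiberPerm_map (hM : IsModel M) (hN : IsModel N) (φ : M ≃[TKLang] N)
    (i : ℕ) (c u : M) :
    numOrbits (hN.fiberPerm i (φ c) (φ u)) = numOrbits (hM.fiberPerm i c u) :=
  (numOrbits_eq_of_semiconj (f := hM.fiberPerm i c u) (g := hN.fiberPerm i (φ c) (φ u))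
    (e := φ.toEquiv.subtypeEquiv fun _ => (map_mem_fiber_iff φ).symm)
    fun x => Subtype.ext (map_app φ (.S i) x)).symm

end Fiber

end TK

/-! ### Standard models of `TK` -/

theorem ncard_length_eq (i : ℕ) : {s : List Bool | s.length = i}.ncard = 2 ^ i := by
  have : Nat.card (List.Vector Bool i) = 2 ^ i := by simp
  exact this

theorem length_eq_and_dropLast_eq_iff {s t : List Bool} :
    t.length = s.length + 1 ∧ t.dropLast = s ↔ t = s ++ [false] ∨ t = s ++ [true] := by
  refine ⟨fun ⟨hlen, h⟩ => ?_, by rintro (rfl | rfl) <;> simp⟩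
  have hne : t ≠ [] := List.ne_nil_of_length_eq_add_one hlen
  obtain rfl | ⟨l, b, rfl⟩ := List.eq_nil_or_concat t
  · exact absurd rfl hne
  · obtain rfl : l = s := by simpa using h
    cases b <;> simp

namespace TK

/-- The standard model of `TK` coded by a sequence of colorings `x`. It consists of the elements
`u n` of `U`, the elements `c s` of `C i` for `s` of length `i`, and the elements `v s n z` of the
fiber over `c s` and `u n`. -/
inductive StdModel (x : ℕ → Coloring)
  | u (n : ℕ)
  | c (s : List Bool)
  | v (s : List Bool) (n z : ℕ)

namespace StdModel

variable {x y : ℕ → Coloring}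

variable (x) in
/-- The standard models as a fixed set, independent of the sequence of colorings. -/
def equivSum : StdModel x ≃ ℕ ⊕ List Bool ⊕ List Bool × ℕ × ℕ where
  toFun
    | u n => .inl n
    | c s => .inr (.inl s)
    | v s n z => .inr (.inr (s, n, z))
  invFun
    | .inl n => u n
    | .inr (.inl s) => c s
    | .inr (.inr (s, n, z)) => v s n z
  left_inv p := by cases p <;> rfl
  right_inv p := by rcases p with n | s | ⟨s, n, z⟩ <;> rfl

instance : Countable (StdModel x) := (equivSum x).injective.countable

theorem c_injective : Function.Injective (c (x := x)) := fun _ _ => c.inj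

theorem u_injective : Function.Injective (u (x := x)) := fun _ _ => u.inj

theorem v_injective (s : List Bool) (n : ℕ) : Function.Injective (v (x := x) s n) :=
  fun _ _ h => (v.inj h).2.2

/-- The sort of a point of a standard model. -/
def pointSort : StdModel x → TKRel 1
  | u _ => .U
  | c s => .C s.length
  | v s _ _ => .V s.length

/-- The functions of a standard model. In the fiber over `c s` and `u n`, the successor function has
`x n s` orbits, or infinitely many if `x n s = 0`. -/
noncomputable def pointFun : TKFun 1 → StdModel x → StdModel x
  | .S i, v s n z => v s n (if s.length = i then acyclicPerm (x n s) z else z)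
  | .pr0 i, v s n z => if s.length = i then c s else v s n z
  | .pr1 i, v s n z => if s.length = i then u n else v s n z
  | .tau i, c s => c (if s.length = i + 1 then s.dropLast else s)
  | _, p => p

noncomputable instance : TKLang.Structure (StdModel x) where
  funMap := fun {n} f v => match n, f, v with
    | 0, f, _ => nomatch f
    | 1, f, v => pointFun f (v 0)
    | _ + 2, f, _ => nomatch f
  RelMap := fun {n} R v => match n, R, v with
    | 0, R, _ => nomatch R
    | 1, s, v => pointSort (v 0) = s
    | _ + 2, R, _ => nomatch R

theorem app_eq : app (StdModel x) = pointFun := rfl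

theorem mem_sort_iff {s : TKRel 1} {p : StdModel x} : p ∈ sort (StdModel x) s ↔ p.pointSort = s :=
  Iff.rfl

theorem sort_U : sort (StdModel x) .U = Set.range u := by
  ext (n | s | ⟨s, n, z⟩) <;> simp [mem_sort_iff, pointSort]

theorem sort_C (i : ℕ) : sort (StdModel x) (.C i) = c '' {s | s.length = i} := by
  ext (n | s | ⟨s, n, z⟩) <;> simp [mem_sort_iff, pointSort]

theorem sort_V (i : ℕ) :
    sort (StdModel x) (.V i) = {p | ∃ s n z, s.length = i ∧ v s n z = p} := by
  ext (n | s | ⟨s, n, z⟩) <;> simp [mem_sort_iff, pointSort]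

theorem app_S (s : List Bool) (n z : ℕ) :
    app (StdModel x) (.S s.length) (v s n z) = v s n (acyclicPerm (x n s) z) := by
  simp [app_eq, pointFun]

theorem app_pr0 (s : List Bool) (n z : ℕ) :
    app (StdModel x) (.pr0 s.length) (v s n z) = c s := by
  simp [app_eq, pointFun]

theorem app_pr1 (s : List Bool) (n z : ℕ) :
    app (StdModel x) (.pr1 s.length) (v s n z) = u n := by
  simp [app_eq, pointFun]

theorem app_tau {i : ℕ} {s : List Bool} (hs : s.length = i + 1) :
    app (StdModel x) (.tau i) (c s) = c s.dropLast := by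
  simp [app_eq, pointFun, hs]

theorem bijOn_S (i : ℕ) : Set.BijOn (app (StdModel x) (.S i)) (sort (StdModel x) (.V i))
    (sort (StdModel x) (.V i)) := by
  rw [sort_V]
  refine ⟨?_, ?_, ?_⟩
  · rintro _ ⟨s, n, z, rfl, rfl⟩
    exact ⟨s, n, _, rfl, (app_S s n z).symm⟩
  · rintro _ ⟨s, n, z, rfl, rfl⟩ _ ⟨t, m, w, hts, rfl⟩ h
    rw [app_S, ← hts, app_S] at h
    obtain ⟨rfl, rfl, h⟩ := v.inj h
    rw [(acyclicPerm _).injective h]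
  · rintro _ ⟨s, n, z, rfl, rfl⟩
    exact ⟨.v s n ((acyclicPerm (x n s)).symm z), ⟨s, n, _, rfl, rfl⟩, by simp [app_S]⟩

theorem tau_fiber (s : List Bool) :
    {d ∈ sort (StdModel x) (.C (s.length + 1)) |
      app (StdModel x) (.tau s.length) d = c s} =
    c '' {s ++ [false], s ++ [true]} := by
  rw [sort_C]
  ext p
  constructor
  · rintro ⟨⟨t, ht, rfl⟩, h⟩
    rw [app_tau ht] at h
    exact ⟨t, length_eq_and_dropLast_eq_iff.1 ⟨ht, c_injective h⟩, rfl⟩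
  · rintro ⟨t, ht, rfl⟩
    obtain ⟨hlen, h⟩ := length_eq_and_dropLast_eq_iff.2 ht
    exact ⟨⟨t, hlen, rfl⟩, by rw [app_tau hlen, h]⟩

theorem S_acyclic (s : List Bool) (n z m : ℕ) (hm : 0 < m) :
    (app (StdModel x) (.S s.length))^[m] (v s n z) ≠ v s n z := fun h => by
  have semiconj : Function.Semiconj (v s n) (acyclicPerm (x n s))
    (app (StdModel x) (.S s.length)) := fun z => (app_S s n z).symm
  rw [← (semiconj.iterate_right m) z] at h
  exact Set.eq_empty_iff_forall_notMem.1 (periodicPts_acyclicPerm (x n s)) z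
    ⟨m, hm, (v.inj h).2.2⟩

theorem mapsTo_app (f : TKFun 1) :
    Set.MapsTo (app (StdModel x) f) (sort (StdModel x) (dom f))
      (sort (StdModel x) (cod f)) := by
  rintro p hp
  cases f <;> rcases p with n | s | ⟨s, n, z⟩ <;>
    simp_all [mem_sort_iff, app_eq, pointFun, pointSort, dom, cod]

theorem app_of_notMem_sort_dom (f : TKFun 1) (p : StdModel x)
    (hp : p ∉ sort (StdModel x) (dom f)) : app (StdModel x) f p = p := by
  cases f <;> rcases p with n | s | ⟨s, n, z⟩ <;>
    simp_all [mem_sort_iff, app_eq, pointFun, pointSort, dom]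

variable (x) in
theorem isModel : IsModel (StdModel x) where
  exists_unique_sort p := ⟨_, rfl, fun _ h => h.symm⟩
  mapsTo := mapsTo_app
  off_dom := app_of_notMem_sort_dom
  infinite_U := sort_U ▸ Set.infinite_range_of_injective u_injective
  infinite_V i := Set.infinite_of_injective_forall_mem
    (f := fun z => v (List.replicate i false) 0 z) (v_injective _ _)
    fun _ => congrArg TKRel.V List.length_replicate
  card_C i := by
    rw [sort_C, Set.ncard_image_of_injective _ c_injective, ncard_length_eq]
  tau_surj i := by
    rw [sort_C, sort_C]
    rintro _ ⟨s, rfl, rfl⟩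
    exact ⟨.c (s ++ [false]), ⟨_, by simp, rfl⟩, by rw [app_tau (by simp)]; simp⟩
  tau_fiber i := by
    rw [sort_C]
    rintro _ ⟨s, rfl, rfl⟩
    rw [tau_fiber, Set.ncard_image_of_injective _ c_injective, Set.ncard_pair (by simp)]
  fiber_nonempty i := by
    rw [sort_C, sort_U]
    rintro _ ⟨s, rfl, rfl⟩ _ ⟨n, rfl⟩
    exact ⟨.v s n 0, rfl, app_pr0 s n 0, app_pr1 s n 0⟩
  S_bij := bijOn_S
  S_acyclic i := by
    rw [sort_V]
    rintro _ ⟨s, n, z, rfl, rfl⟩ m hm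
    exact S_acyclic s n z m hm
  pr0_S i := by
    rw [sort_V]
    rintro _ ⟨s, n, z, rfl, rfl⟩
    rw [app_S, app_pr0, app_pr0]
  pr1_S i := by
    rw [sort_V]
    rintro _ ⟨s, n, z, rfl, rfl⟩
    rw [app_S, app_pr1, app_pr1]

theorem fiber_eq_range (s : List Bool) (n : ℕ) :
    fiber (StdModel x) s.length (c s) (u n) = Set.range (v s n) := by
  ext p
  simp only [fiber, sort_V]
  constructor
  · rintro ⟨⟨t, m, z, hts, rfl⟩, h0, h1⟩
    rw [← hts, app_pr0] at h0
    rw [← hts, app_pr1] at h1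
    exact ⟨z, by rw [c_injective h0, u_injective h1]⟩
  · rintro ⟨z, rfl⟩
    exact ⟨⟨s, n, z, rfl, rfl⟩, app_pr0 s n z, app_pr1 s n z⟩

variable (x) in
theorem numOrbits_fiberPerm (s : List Bool) (n : ℕ) :
    numOrbits ((isModel x).fiberPerm s.length (c s) (u n)) = x n s := by
  let e : ℕ ≃ fiber (StdModel x) s.length (c s) (u n) :=
    (Equiv.ofInjective (v s n) (v_injective s n)).trans
      (Equiv.setCongr (fiber_eq_range s n).symm)
  have he : Function.Semiconj e (acyclicPerm (x n s)) ((isModel x).fiberPerm s.length _ _) :=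
    fun z => Subtype.ext (app_S s n z).symm
  rw [← numOrbits_eq_of_semiconj he, numOrbits_acyclicPerm]

end StdModel

/-! ### Frames -/

/-- A frame of a model of `TK` is an isomorphism of the binary tree with the tree `⋃ i, C i`,
together with an enumeration of `U` without repetitions. -/
structure IsFrame {M : Type*} [TKLang.Structure M] (node : List Bool → M) (pt : ℕ → M) : Prop where
  bijOn_node : ∀ i, Set.BijOn node {s | s.length = i} (sort M (.C i))
  app_tau_node : ∀ i s, s.length = i + 1 → app M (.tau i) (node s) = node s.dropLast
  bijOn_pt : Set.BijOn pt Set.univ (sort M .U)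

namespace StdModel

section Realize

variable {M : Type*} [TKLang.Structure M] {node : List Bool → M} {pt : ℕ → M} {x : ℕ → Coloring}

/-- The map from a standard model to a model `M` that sends the `c s` to `node s`, the `u n` to
`pt n`, and the fiber over `c s` and `u n` to the fiber over `node s` and `pt n` by `e s n`. -/
def realize (e : ∀ s n, ℕ ≃ fiber M s.length (node s) (pt n)) : StdModel x → M
  | u n => pt n
  | c s => node s
  | v s n z => e s n z

theorem bijOn_realize_V (h : IsFrame node pt) (hM : IsModel M)
    (e : ∀ s n, ℕ ≃ fiber M s.length (node s) (pt n)) (i : ℕ) :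
    Set.BijOn (realize (x := x) e) (sort (StdModel x) (.V i)) (sort M (.V i)) := by
  rw [sort_V]
  refine ⟨?_, ?_, fun b hb => ?_⟩
  · rintro _ ⟨s, n, z, rfl, rfl⟩
    exact (e s n z).2.1
  · rintro _ ⟨s, n, z, rfl, rfl⟩ _ ⟨t, m, w, hts, rfl⟩ (hvw : (e s n z : M) = e t m w)
    obtain ⟨-, hs, hn⟩ := (e s n z).2
    obtain ⟨-, ht, hm⟩ := (e t m w).2
    rw [hvw, ← hts] at hs hn
    obtain rfl : s = t := (h.bijOn_node _).injOn rfl hts (hs.symm.trans ht)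
    obtain rfl : n = m := h.bijOn_pt.injOn trivial trivial (hn.symm.trans hm)
    rw [(e s n).injective (Subtype.ext hvw)]
  · obtain ⟨s, rfl, hs⟩ := (h.bijOn_node i).surjOn (hM.mapsTo (.pr0 i) hb)
    obtain ⟨n, -, hn⟩ := h.bijOn_pt.surjOn (hM.mapsTo (.pr1 s.length) hb)
    obtain ⟨z, hz⟩ := (e s n).surjective ⟨b, hb, hs.symm, hn.symm⟩
    exact ⟨v s n z, ⟨s, n, z, rfl, rfl⟩, congrArg Subtype.val hz⟩

theorem bijOn_realize (h : IsFrame node pt) (hM : IsModel M)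
    (e : ∀ s n, ℕ ≃ fiber M s.length (node s) (pt n)) :
    ∀ s, Set.BijOn (realize (x := x) e) (sort (StdModel x) s) (sort M s)
  | .U => by
    rw [sort_U, ← Set.image_univ]
    exact (Set.bijOn_comp_iff u_injective.injOn).1 h.bijOn_pt
  | .C i => by
    rw [sort_C]
    exact (Set.bijOn_comp_iff c_injective.injOn).1 (h.bijOn_node i)
  | .V i => bijOn_realize_V h hM e i

theorem realize_app (h : IsFrame node pt) (hM : IsModel M)
    {e : ∀ s n, ℕ ≃ fiber M s.length (node s) (pt n)}
    (he : ∀ s n, Function.Semiconj (e s n) (acyclicPerm (x n s)) (hM.fiberPerm _ _ _)) :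
    ∀ f, ∀ p ∈ sort (StdModel x) (dom f),
      realize e (app (StdModel x) f p) = app M f (realize e p)
  | .S i => by
    rw [dom, sort_V]
    rintro _ ⟨s, n, z, rfl, rfl⟩
    rw [app_S]
    exact congrArg Subtype.val (he s n z)
  | .pr0 i => by
    rw [dom, sort_V]
    rintro _ ⟨s, n, z, rfl, rfl⟩
    rw [app_pr0]
    exact (e s n z).2.2.1.symm
  | .pr1 i => by
    rw [dom, sort_V]
    rintro _ ⟨s, n, z, rfl, rfl⟩
    rw [app_pr1]
    exact (e s n z).2.2.2.symm
  | .tau i => by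
    rw [dom, sort_C]
    rintro _ ⟨s, hs, rfl⟩
    rw [app_tau hs]
    exact (h.app_tau_node i s hs).symm

theorem nonempty_equiv_of_isFrame [Countable M] (h : IsFrame node pt) (hM : IsModel M)
    (hx : ∀ n s, numOrbits (hM.fiberPerm s.length (node s) (pt n)) = x n s) :
    Nonempty (StdModel x ≃[TKLang] M) := by
  have (s : List Bool) (n : ℕ) : Nonempty (fiber M s.length (node s) (pt n)) :=
    have ⟨a, ha⟩ :=
      hM.fiber_nonempty _ _ ((h.bijOn_node _).mapsTo rfl) _ (h.bijOn_pt.mapsTo trivial)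
    ⟨⟨a, ha⟩⟩
  choose e he using fun s n => exists_semiconj_of_numOrbits_eq
    (periodicPts_acyclicPerm (x n s)) (hM.periodicPts_fiberPerm s.length (node s) (pt n))
    ((numOrbits_acyclicPerm _).trans (hx n s).symm)
  exact (isModel x).nonempty_equiv_of_bijOn_sort hM (bijOn_realize h hM e) (realize_app h hM he)

end Realize

end StdModel

end TK

/-! ### The model coded by a sequence of colorings -/

theorem nonempty_equiv_congr {L : FirstOrder.Language} {M N M' N' : Type*} [L.Structure M]
    [L.Structure N] [L.Structure M'] [L.Structure N'] (e : M ≃[L] M') (e' : N ≃[L] N') :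
    Nonempty (M ≃[L] N) ↔ Nonempty (M' ≃[L] N') :=
  ⟨fun ⟨φ⟩ => ⟨e'.comp (φ.comp e.symm)⟩, fun ⟨φ⟩ => ⟨e'.symm.comp (φ.comp e)⟩⟩

theorem exists_perm_of_mem_range_iff {α β ι : Type*} {f : ι → α} {g : ι → β}
    (hf : Function.Injective f) (hg : Function.Injective g) (e : α ≃ β)
    (h : ∀ a, a ∈ Set.range f ↔ e a ∈ Set.range g) :
    ∃ σ : Equiv.Perm ι, ∀ i, e (f i) = g (σ i) := by
  refine ⟨(Equiv.ofInjective f hf).trans ((e.subtypeEquiv h).trans (Equiv.ofInjective g hg).symm),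
    fun i => ?_⟩
  simp [Equiv.apply_ofInjective_symm]

namespace TK

namespace StdModel

variable {x y : ℕ → Coloring}

theorem mem_range_c_iff {p : StdModel x} : p ∈ Set.range c ↔ ∃ i, p ∈ sort (StdModel x) (.C i) := by
  simp only [sort_C, Set.mem_image, Set.mem_ofPred_eq, Set.mem_range]
  exact ⟨fun ⟨s, hs⟩ => ⟨_, s, rfl, hs⟩, fun ⟨_, s, _, hs⟩ => ⟨s, hs⟩⟩

theorem exists_perm_u_eq (φ : StdModel x ≃[TKLang] StdModel y) :
    ∃ σ : Equiv.Perm ℕ, ∀ n, φ (u n) = u (σ n) :=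
  exists_perm_of_mem_range_iff u_injective u_injective φ.toEquiv fun p => by
    rw [← sort_U, ← sort_U]
    exact (map_mem_sort_iff φ .U p).symm

theorem exists_treeAut_c_eq (φ : StdModel x ≃[TKLang] StdModel y) :
    ∃ g : TreeAut, ∀ s, φ (c s) = c (g s) := by
  obtain ⟨e, he⟩ := exists_perm_of_mem_range_iff c_injective c_injective φ.toEquiv fun p => by
    rw [mem_range_c_iff, mem_range_c_iff]
    exact exists_congr fun i => (map_mem_sort_iff φ (.C i) p).symm
  have hφ (s : List Bool) : φ (c s) = c (e s) := he s
  have length_e (s : List Bool) : (e s).length = s.length := by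
    have : φ (c s) ∈ sort (StdModel y) (.C s.length) := (map_mem_sort_iff φ _ _).2 rfl
    rw [hφ] at this
    exact TKRel.C.inj this
  refine ⟨TreeAut.ofEquiv e fun s => ?_, hφ⟩
  obtain rfl | ⟨i, hi⟩ : s = [] ∨ ∃ i, s.length = i + 1 := by cases s <;> simp
  · rw [List.eq_nil_of_length_eq_zero (length_e []), List.dropLast_nil,
      List.eq_nil_of_length_eq_zero (length_e [])]
  · apply c_injective (x := y)
    rw [← app_tau ((length_e s).trans hi), ← hφ, ← hφ, ← map_app, app_tau hi]

theorem isFrame (g : TreeAut) (σ : Equiv.Perm ℕ) :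
    IsFrame (fun s => c (x := x) (g s)) fun n => u (x := x) (σ n) where
  bijOn_node i := by
    rw [sort_C]
    exact c_injective.injOn.bijOn_image.comp
      (g.toEquiv.bijOn fun s => iff_of_eq (congrArg (· = i) (TreeAut.length_apply g s)))
  app_tau_node i s hs := by
    rw [app_tau (by rw [TreeAut.length_apply, hs]), TreeAut.apply_dropLast]
  bijOn_pt := by
    rw [sort_U, ← Set.image_univ]
    exact u_injective.injOn.bijOn_image.comp (σ.bijective.bijOn_univ)

theorem nonempty_equiv_iff_coloringEquiv :
    Nonempty (StdModel x ≃[TKLang] StdModel y) ↔ ColoringEquiv x y := by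
  rw [coloringEquiv_iff]
  constructor
  · rintro ⟨φ⟩
    obtain ⟨g, hg⟩ := exists_treeAut_c_eq φ
    obtain ⟨σ, hσ⟩ := exists_perm_u_eq φ
    refine ⟨g, σ, fun n s => ?_⟩
    rw [← numOrbits_fiberPerm x s n, ← numOrbits_fiberPerm y (g s) (σ n), TreeAut.length_apply,
      ← (isModel x).numOrbits_fiberPerm_map (isModel y) φ, hg, hσ]
  · rintro ⟨g, σ, h⟩
    refine nonempty_equiv_of_isFrame (isFrame g σ) (isModel y) fun n s => ?_
    rw [← h, ← numOrbits_fiberPerm y (g s) (σ n), TreeAut.length_apply]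

/-- A numbering of the points of the standard models, which do not depend on the colorings. -/
noncomputable def sumNumbering : ℕ ⊕ List Bool ⊕ List Bool × ℕ × ℕ ≃ ℕ :=
  nonempty_equiv_of_countable.some

variable (x) in
/-- The fixed numbering of points, on the standard model of a sequence of colorings. -/
noncomputable def numbering : StdModel x ≃ ℕ :=
  (equivSum x).trans sumNumbering

end StdModel

/-- The standard model coded by a sequence of colorings, with its universe transferred to `ℕ`. -/
noncomputable abbrev ofColorings (x : ℕ → Coloring) : TKLang.Structure ℕ :=
  (StdModel.numbering x).inducedStructure

/-- The identification of the standard model with its copy on `ℕ`. -/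
noncomputable def ofColoringsEquiv (x : ℕ → Coloring) :
    @Language.Equiv TKLang (StdModel x) ℕ _ (ofColorings x) :=
  (StdModel.numbering x).inducedStructureEquiv

theorem ofColorings_mem_TKMod (x : ℕ → Coloring) : ofColorings x ∈ TKMod :=
  @IsModel.of_equiv (StdModel x) ℕ _ (ofColorings x) (ofColoringsEquiv x) (StdModel.isModel x)

theorem nonempty_equiv_ofColorings_iff (x y : ℕ → Coloring) :
    Nonempty (@Language.Equiv TKLang ℕ ℕ (ofColorings x) (ofColorings y)) ↔ ColoringEquiv x y :=
  (@nonempty_equiv_congr _ _ _ _ _ _ _ (ofColorings x) (ofColorings y) (ofColoringsEquiv x)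
    (ofColoringsEquiv y)).symm.trans StdModel.nonempty_equiv_iff_coloringEquiv

namespace StdModel

theorem pointSort_numbering_symm (x y : ℕ → Coloring) (k : ℕ) :
    pointSort ((numbering x).symm k) = pointSort ((numbering y).symm k) := by
  simp only [numbering, Equiv.symm_trans_apply]
  generalize Equiv.symm _ k = p
  rcases p with n | s | ⟨s, n, z⟩ <;> rfl

theorem continuous_pointFun_numbering (f : TKFun 1) (k : ℕ) :
    Continuous fun x => numbering x (pointFun f ((numbering x).symm k)) := by
  simp only [numbering, Equiv.symm_trans_apply, Equiv.trans_apply]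
  generalize Equiv.symm _ k = p
  cases f <;> rcases p with n | s | ⟨s, n, z⟩ <;>
    simp only [equivSum, Equiv.coe_fn_mk, Equiv.coe_fn_symm_mk, pointFun, apply_ite] <;>
    try exact continuous_const
  exact .if_const _ ((continuous_of_discreteTopology (f := fun j =>
    sumNumbering (.inr (.inr (s, n, acyclicPerm j z))))).comp (continuous_apply_apply n s))
      continuous_const

end StdModel

theorem continuous_ofColorings : Continuous ofColorings := by
  refine continuous_generateFrom_iff.2 ?_
  rintro A (⟨n, f, v, k, rfl⟩ | ⟨n, R, v, h⟩)
  · match n, f with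
    | 1, f => exact (isOpen_discrete {k}).preimage (StdModel.continuous_pointFun_numbering f (v 0))
  · match n, R with
    | 1, R =>
      have relMap_iff (x : ℕ → Coloring) : (ofColorings x).RelMap (n := 1) R v ↔
          StdModel.pointSort ((StdModel.numbering 0).symm (v 0)) = R := by
        rw [StdModel.pointSort_numbering_symm 0 x]
        rfl
      rcases h with rfl | rfl <;> simp only [Set.preimage_ofPred_eq, relMap_iff] <;>
        exact isOpen_const

end TK

theorem coloringEquiv_borelReducible_isoOn_TKMod : BorelReducible ColoringEquiv (IsoOn TKMod) :=
  .of_measurable (f := fun x => (⟨TK.ofColorings x, TK.ofColorings_mem_TKMod x⟩ : TKMod))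
    (TK.continuous_ofColorings.subtype_mk _).measurable
    fun x y => (TK.nonempty_equiv_ofColorings_iff x y).symm

/-! ### Measurability of natural numbers defined from a structure -/

section Measurability

variable {Ω α β : Type*} [MeasurableSpace Ω]

theorem measurable_apply_of_countable [MeasurableSpace α] [MeasurableSpace β] [Countable α]
    [MeasurableSingletonClass α] {F : Ω → α → β} {a : Ω → α}
    (hF : ∀ i, Measurable fun ω => F ω i) (ha : Measurable a) : Measurable fun ω => F ω (a ω) :=
  (measurable_from_prod_countable_left (f := fun p : Ω × α => F p.1 p.2) hF).comp
    (measurable_id.prodMk ha)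

theorem measurable_eq_of_nat {a b : Ω → ℕ} (ha : Measurable a) (hb : Measurable b) :
    Measurable fun ω => a ω = b ω :=
  measurableSet_setOfPred.1 (measurableSet_eq_fun ha hb)

theorem nat_sInf_eq_iff {A : Set ℕ} {k : ℕ} :
    sInf A = k ↔ (k ∈ A ∧ ∀ j < k, j ∉ A) ∨ (k = 0 ∧ ∀ j, j ∉ A) := by
  constructor
  · rintro rfl
    rcases A.eq_empty_or_nonempty with rfl | h
    · simp
    · exact .inl ⟨Nat.sInf_mem h, fun j => Nat.notMem_of_lt_sInf⟩
  · rintro (⟨hk, hlt⟩ | ⟨rfl, h⟩)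
    · exact (Nat.sInf_le hk).antisymm (not_lt.1 fun h => hlt _ h (Nat.sInf_mem ⟨k, hk⟩))
    · rw [Set.eq_empty_of_forall_notMem h, Nat.sInf_empty]

theorem measurable_nat_sInf {A : Ω → Set ℕ} (hA : ∀ a, Measurable fun ω => a ∈ A ω) :
    Measurable fun ω => sInf (A ω) := by
  refine measurable_to_countable' fun k => ?_
  simp only [Set.preimage, Set.mem_singleton_iff, nat_sInf_eq_iff]
  rw [measurableSet_setOfPred]
  fun_prop

theorem measurable_nth {p : Ω → ℕ → Prop} (hp : ∀ a, Measurable fun ω => p ω a) (n : ℕ) :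
    Measurable fun ω => Nat.nth (p ω) n := by
  induction n using Nat.strong_induction_on with
  | _ n ih =>
    simp only [Nat.nth_eq_sInf _ n]
    refine measurable_nat_sInf fun a => (hp a).and (.forall fun k => ?_)
    by_cases hk : k < n
    · simpa only [hk, forall_const] using
        measurableSet_setOfPred.1 (measurableSet_lt (ih k hk) measurable_const)
    · simpa only [hk, IsEmpty.forall_iff] using measurable_const

theorem measurable_ncard_of_mem [Countable α] {A : Ω → Set α}
    (hA : ∀ a, Measurable fun ω => a ∈ A ω) : Measurable fun ω => (A ω).ncard :=
  measurable_ncard.comp (measurable_set_iff.2 hA)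

end Measurability

/-! ### A sequence of colorings from a model of `TK` -/

theorem bijOn_nth_of_finite {K : Set ℕ} (hK : K.Finite) :
    Set.BijOn (Nat.nth (· ∈ K)) (Set.Iio K.ncard) K := by
  rw [Set.ncard_eq_toFinset_card K hK]
  have himage := Nat.image_nth_Iio_card (p := (· ∈ K)) hK
  have hinj := Nat.nth_injOn (p := (· ∈ K)) hK
  exact ⟨fun n hn => himage.subset ⟨n, hn, rfl⟩, hinj, himage.superset⟩

theorem bijOn_nth_of_infinite {K : Set ℕ} (hK : K.Infinite) :
    Set.BijOn (Nat.nth (· ∈ K)) Set.univ K := by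
  have himage := Nat.range_nth_of_infinite (p := (· ∈ K)) hK
  rw [← Set.image_univ] at himage
  exact ⟨fun n hn => himage.subset ⟨n, hn, rfl⟩,
    (Nat.nth_injective (p := (· ∈ K)) hK).injOn, himage.superset⟩

theorem bijOn_nth_toNat {K : Set ℕ} (hK : K.ncard = 2) :
    Set.BijOn (fun b : Bool => Nat.nth (· ∈ K) b.toNat) Set.univ K := by
  have hfin := bijOn_nth_of_finite (Set.finite_of_ncard_ne_zero (hK ▸ two_ne_zero))
  have toNat : Set.BijOn Bool.toNat Set.univ (Set.Iio K.ncard) := by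
    rw [hK]
    refine ⟨fun b _ => b.toNat_lt, Function.Injective.injOn (by decide), fun n (hn : n < 2) => ?_⟩
    interval_cases n
    exacts [⟨false, trivial, rfl⟩, ⟨true, trivial, rfl⟩]
  exact hfin.comp toNat

theorem exists_eq_append_singleton_of_length_eq {α : Type*} {s : List α} {i : ℕ}
    (hs : s.length = i + 1) : ∃ t b, t.length = i ∧ s = t ++ [b] :=
  ⟨s.dropLast, s.getLast (List.ne_nil_of_length_eq_add_one hs), by simp [hs],
    (List.dropLast_append_getLast _).symm⟩

theorem bijOn_length_succ {α : Type*} {node : List Bool → α} {p : α → α} {A B : Set α} {i : ℕ}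
    (hnode : Set.BijOn node {s | s.length = i} A) (hp : Set.MapsTo p B A)
    (hchild : ∀ s, s.length = i →
      Set.BijOn (fun b => node (s ++ [b])) Set.univ {d ∈ B | p d = node s}) :
    Set.BijOn node {s | s.length = i + 1} B := by
  refine ⟨fun s hs => ?_, fun s hs t ht hst => ?_, fun d hd => ?_⟩
  · obtain ⟨s, b, hs', rfl⟩ := exists_eq_append_singleton_of_length_eq hs
    exact ((hchild s hs').mapsTo (Set.mem_univ b)).1
  · obtain ⟨s, b, hs', rfl⟩ := exists_eq_append_singleton_of_length_eq hs
    obtain ⟨t, c, ht', rfl⟩ := exists_eq_append_singleton_of_length_eq ht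
    obtain rfl : s = t := hnode.injOn hs' ht' <| by
      rw [← ((hchild s hs').mapsTo (Set.mem_univ b)).2,
        ← ((hchild t ht').mapsTo (Set.mem_univ c)).2]
      exact congrArg p hst
    rw [(hchild s hs').injOn (Set.mem_univ b) (Set.mem_univ c) hst]
  · obtain ⟨s, hs, hsd⟩ := hnode.surjOn (hp hd)
    obtain ⟨b, -, hb⟩ := (hchild s hs).surjOn ⟨hd, hsd.symm⟩
    exact ⟨s ++ [b], by simpa using hs, hb⟩

namespace TK

section Model

variable (M : TKLang.Structure ℕ)

/-- The points of `C (i + 1)` that lie above a point `c` of `C i`. -/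
def children (i c : ℕ) : Set ℕ := {d ∈ sort ℕ (.C (i + 1)) | app ℕ (.tau i) d = c}

/-- The point of the tree `⋃ i, C i` that is reached by following a binary sequence, which is given
in reverse order. The bits select the smaller or the larger child. -/
noncomputable def nodeOfReverse : List Bool → ℕ
  | [] => Nat.nth (· ∈ sort ℕ (.C 0)) 0
  | b :: s => Nat.nth (· ∈ children M s.length (nodeOfReverse s)) b.toNat

/-- The point of the tree `⋃ i, C i` that is reached by following a binary sequence. -/
noncomputable def node (s : List Bool) : ℕ := nodeOfReverse M s.reverse

/-- The increasing enumeration of `U`. -/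
noncomputable def enumU (n : ℕ) : ℕ := Nat.nth (· ∈ sort ℕ .U) n

/-- The colorings that record the numbers of orbits of the successor functions on the fibers, where
`0` stands for infinitely many orbits. -/
noncomputable def toColorings (n : ℕ) : Coloring := fun s =>
  (orbitReps (app ℕ (.S s.length)) (fiber ℕ s.length (node M s) (enumU M n))).ncard

theorem node_nil : node M [] = Nat.nth (· ∈ sort ℕ (.C 0)) 0 := rfl

theorem node_append_singleton (s : List Bool) (b : Bool) :
    node M (s ++ [b]) = Nat.nth (· ∈ children M s.length (node M s)) b.toNat := by
  simp [node, nodeOfReverse]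

variable {M}

theorem bijOn_node_zero (hM : IsModel ℕ) :
    Set.BijOn (node M) {s | s.length = 0} (sort ℕ (.C 0)) := by
  have hcard := hM.card_C 0
  obtain ⟨c, hc⟩ := Set.ncard_eq_one.1 hcard
  have hmem := (bijOn_nth_of_finite (hc ▸ Set.finite_singleton c)).mapsTo (x := 0) (by simp [hcard])
  have hnil : {s : List Bool | s.length = 0} = {[]} := by ext; simp
  rw [← node_nil M, hc] at hmem
  rw [hc, hnil, Set.bijOn_singleton, Set.mem_singleton_iff.1 hmem]

theorem bijOn_node_append (hM : IsModel ℕ) {s : List Bool}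
    (hs : node M s ∈ sort ℕ (.C s.length)) :
    Set.BijOn (fun b => node M (s ++ [b])) Set.univ (children M s.length (node M s)) := by
  simp only [node_append_singleton]
  exact bijOn_nth_toNat (hM.tau_fiber _ _ hs)

theorem bijOn_node (hM : IsModel ℕ) (i : ℕ) :
    Set.BijOn (node M) {s | s.length = i} (sort ℕ (.C i)) := by
  induction i with
  | zero => exact bijOn_node_zero hM
  | succ i ih =>
    refine bijOn_length_succ ih (hM.mapsTo (.tau i)) fun s hs => ?_
    subst hs
    exact bijOn_node_append hM (ih.mapsTo rfl)

theorem isFrame_node_enumU (hM : IsModel ℕ) : IsFrame (node M) (enumU M) where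
  bijOn_node := bijOn_node hM
  app_tau_node i s hs := by
    obtain ⟨s, b, rfl, rfl⟩ := exists_eq_append_singleton_of_length_eq hs
    rw [List.dropLast_concat]
    exact ((bijOn_node_append hM ((bijOn_node hM _).mapsTo rfl)).mapsTo (Set.mem_univ b)).2
  bijOn_pt := bijOn_nth_of_infinite hM.infinite_U

theorem nonempty_equiv_toColorings (hM : IsModel ℕ) :
    Nonempty (StdModel (toColorings M) ≃[TKLang] ℕ) :=
  StdModel.nonempty_equiv_of_isFrame (isFrame_node_enumU hM) hM fun _ _ =>
    (ncard_orbitReps (hM.bijOn_fiber _ _ _)).symm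

end Model

theorem measurable_mem_sort (s : TKRel 1) (a : ℕ) :
    Measurable fun M : TKLang.Structure ℕ => a ∈ @sort ℕ M s :=
  measurable_relMap (L := TKLang) (n := 1) s ![a]

theorem measurable_app (f : TKFun 1) {a : TKLang.Structure ℕ → ℕ} (ha : Measurable a) :
    Measurable fun M : TKLang.Structure ℕ => @app ℕ M f (a M) :=
  measurable_apply_of_countable (F := fun M => @app ℕ M f)
    (fun i => measurable_funMap (L := TKLang) (n := 1) f ![i]) ha

theorem measurable_iterate_app (f : TKFun 1) (m a : ℕ) :
    Measurable fun M : TKLang.Structure ℕ => (@app ℕ M f)^[m] a := by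
  induction m with
  | zero => exact measurable_const
  | succ m ih => simpa only [Function.iterate_succ_apply'] using measurable_app f ih

theorem measurable_nodeOfReverse (s : List Bool) : Measurable fun M => nodeOfReverse M s := by
  induction s with
  | nil => exact measurable_nth (fun a => measurable_mem_sort _ a) 0
  | cons b s ih =>
    exact measurable_nth (fun a => (measurable_mem_sort _ a).and
      (measurable_eq_of_nat (measurable_app _ measurable_const) ih)) _

theorem measurable_enumU (n : ℕ) : Measurable fun M => enumU M n :=
  measurable_nth (fun a => measurable_mem_sort _ a) n

theorem measurable_mem_fiber (i x : ℕ) {c u : TKLang.Structure ℕ → ℕ} (hc : Measurable c)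
    (hu : Measurable u) :
    Measurable fun M : TKLang.Structure ℕ => x ∈ @fiber ℕ M i (c M) (u M) :=
  (measurable_mem_sort _ x).and <|
    (measurable_eq_of_nat (measurable_app _ measurable_const) hc).and
      (measurable_eq_of_nat (measurable_app _ measurable_const) hu)

theorem measurable_toColorings : Measurable toColorings := by
  refine measurable_pi_lambda _ fun n => measurable_pi_lambda _ fun s => ?_
  have hfiber (a : ℕ) := measurable_mem_fiber s.length a
    (measurable_nodeOfReverse s.reverse) (measurable_enumU n)
  have hiter (m a b : ℕ) := measurable_eq_of_nat (measurable_iterate_app (.S s.length) m a)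
    (measurable_const (a := b))
  exact measurable_ncard_of_mem fun a => (hfiber a).and <| .forall fun b => (hfiber b).imp <|
    .imp (.exists fun m => (hiter m a b).or (hiter m b a)) measurable_const

end TK

theorem isoOn_TKMod_borelReducible_coloringEquiv : BorelReducible (IsoOn TKMod) ColoringEquiv := by
  refine .of_measurable (f := fun M : TKMod => TK.toColorings M.1)
    (TK.measurable_toColorings.comp measurable_subtype_coe) fun ⟨M, hM⟩ ⟨N, hN⟩ => ?_
  obtain ⟨e⟩ := TK.nonempty_equiv_toColorings hM
  obtain ⟨e'⟩ := TK.nonempty_equiv_toColorings hN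
  exact (@nonempty_equiv_congr _ _ _ _ _ _ _ M N e e').symm.trans
    TK.StdModel.nonempty_equiv_iff_coloringEquiv

theorem countable_symbols_graph : Countable FirstOrder.Language.graph.Symbols := by
  have (n : ℕ) : Countable (FirstOrder.Language.graph.Relations n) := inferInstance
  have (n : ℕ) : IsEmpty (FirstOrder.Language.graph.Functions n) := inferInstance
  infer_instance

theorem mainTheorem4 :
    BorelReducible (IsoOn GraphMod) ColoringEquiv ∧
    BorelBireducible (IsoOn TKMod) ColoringEquiv ∧
    BorelComplete TKMod := by
  have := countable_symbols_graph
  exact ⟨isoOn_borelReducible_coloringEquiv GraphMod,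
    ⟨isoOn_TKMod_borelReducible_coloringEquiv, coloringEquiv_borelReducible_isoOn_TKMod⟩,
    fun L' _ Ψ => (isoOn_borelReducible_coloringEquiv (InfMod Ψ)).trans
      coloringEquiv_borelReducible_isoOn_TKMod⟩
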